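/- **Model.** There are $m\ge 1$ unrelated machines; machine $i$ has a power function $f_i:[0,\infty)\to[0,\infty)$ that is strictly convex with $f_i(0)=0$; let $g_i=f_i^{-1}$. Finitely many jobs arrive over time; job $j$ has release time $r_j\ge 0$, weight $w_j>0$, size $p_j>0$ and rate $\ell_{ij}\ge 0$ on machine $i$. At every time $t$ a schedule places each job on a single machine, runs machine $i$ at a speed $S(i,t)\ge 0$ using power $f_i(S(i,t))$, and divides this speed among the jobs on $i$ into processing powers $\nu_j(t)\ge 0$ with $\sum_j \nu_j(t)\le S(i,t)$. Job $j$ on machine $i$ is then processed at rate $\ell_{ij}\nu_j(t)$, or $s\,\ell_{ij}\nu_j(t)$ if the scheduler has speed augmentation $s$ (same energy). Preemption and migration are free. $C_j$ is the earliest time by which $p_j$ units of $j$ have been processed after $r_j$, and $F_j=C_j-r_j$; job $j$ is active during $[r_j,C_j)$. The cost is $\sum_j w_jF_j+\sum_i\int_0^\infty f_i(S(i,t))\,dt$. A non-clairvoyant online algorithm knows the $f_i$, and its decision at time $t$ is a function only of the jobs released by time $t$, their $r_j,w_j,\ell_{ij}$, and the completion times that are at most $t$; it does not see sizes. **Theorem.**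 There is an absolute constant $C>0$ such that for every $\varepsilon>0$ and all machines as above there is a non-clairvoyant online algorithm (SelfishMigrate-Energy) which, on every instance, when run with speed augmentation $1+\varepsilon$, produces a feasible schedule with the following properties. 1. *Competitiveness.* Its cost is at most $C\max(1,1/\varepsilon^2)$ times the cost of any feasible offline schedule without augmentation. That is, it is $(1+\varepsilon)$-speed $O(1/\varepsilon^2)$-competitive for weighted flow-time plus energy. 2. *Migrations.* While active, every job changes its machine at most $C\max(1,1/\varepsilon)\,(\log W+\log n)$ times, where $n$ is the number of jobs and $W$ is the ratio of the maximum to the minimum job weight. 3. *Form of the algorithm.* Let $k=\lceil 3/\varepsilon\rceil$ and $\delta=1/k$. At all times the active jobs on machine $i$ form a virtual queue. Let $W(i,t)$ be their total weight, and for an active job $j$ let $\mathcal W_j(t)$ be the total weight of the jobs ahead of $j$ in its queue. Then $f_i(S(i,t))=W(i,t)$, and each job $j$ in this queue gets $$\nu_j(t)=S(i,t)\,\frac{(\mathcal W_j(t)+w_j)^{k+1}-\mathcal W_j(t)^{k+1}}{W(i,t)^{k+1}}.$$ The virtual utility of $j$ on machine $i$ with weight $x$ ahead of it is $g_i(x+w_j)\,\ell_{ij}/(x+w_j)$.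 A completed job leaves its queue. An arriving job joins the tail of the queue on which its virtual utility is largest. A job migrates only to the tail of the queue of its best response among the other machines, and only if this multiplies its virtual utility by more than $1+\delta$. The queues change only at isolated times, by completions followed by a finite sequence of such arrivals and migrations, and at every time no active job could multiply its virtual utility by more than $1+\delta$ by moving to the tail of another queue. -/

import Mathlib

open scoped ENNReal

noncomputable section

namespace FlowEnergy

/-- A power function `f : [0, ∞) → [0, ∞)`: strictly convex with `f 0 = 0`. Only the values of
`f` on `[0, ∞)` matter. Such an `f` is a continuous increasing bijection of `[0, ∞)`. -/
structure IsPowerFunction (f : ℝ → ℝ) : Prop where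
  map_zero : f 0 = 0
  nonneg : ∀ s, 0 ≤ s → 0 ≤ f s
  strictConvexOn : StrictConvexOn ℝ (Set.Ici 0) f

/-- The inverse `g = f⁻¹ : [0, ∞) → [0, ∞)` of a power function. -/
def powerInv (f : ℝ → ℝ) : ℝ → ℝ := Function.invFunOn f (Set.Ici 0)

/-- An instance on `m` unrelated machines: finitely many jobs (named by natural numbers), job `j`
with release time `r_j`, weight `w_j`, size `p_j`, and processing rate `ℓ_{ij}` on machine `i`. -/
structure JobInstance (m : ℕ) where
  jobs : Finset ℕ
  release : ℕ → ℝ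
  weight : ℕ → ℝ
  size : ℕ → ℝ
  rate : Fin m → ℕ → ℝ
  release_nonneg : ∀ j ∈ jobs, 0 ≤ release j
  weight_pos : ∀ j ∈ jobs, 0 < weight j
  size_pos : ∀ j ∈ jobs, 0 < size j
  rate_nonneg : ∀ i, ∀ j ∈ jobs, 0 ≤ rate i j

/-- The ratio of the maximum job weight to the minimum job weight. -/
def JobInstance.weightRatio {m : ℕ} (I : JobInstance m) : ℝ :=
  sSup (I.weight '' (I.jobs : Set ℕ)) / sInf (I.weight '' (I.jobs : Set ℕ))

/-- What a scheduler fixes at one instant: the machine of every job, the processing power `ν_j`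
given to every job on its machine, and the speed `S_i` at which every machine runs. -/
structure Decision (m : ℕ) where
  machine : ℕ → Fin m
  share : ℕ → ℝ
  speed : Fin m → ℝ

/-- A schedule gives a decision for every instant of time. In particular a job is on only one
machine at a time. -/
abbrev Schedule (m : ℕ) := ℝ → Decision m

section Run

variable {m : ℕ} (aug : ℝ) (I : JobInstance m) (S : Schedule m)

/-- The amount of job `j` processed during `[r_j, t]`, when the speed augmentation is `aug`:
job `j` on machine `i` is processed at rate `aug * ℓ_{ij} * ν_j`. -/
def processed (j : ℕ) (t : ℝ) : ℝ≥0∞ :=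
  ∫⁻ s in Set.Ioc (I.release j) t, ENNReal.ofReal (aug * I.rate ((S s).machine j) j * (S s).share j)

/-- The completion time `C_j` (`∞` if the job is never completed). -/
def completionTime (j : ℕ) : ℝ≥0∞ :=
  sInf (ENNReal.ofReal ''
    {t : ℝ | I.release j ≤ t ∧ ENNReal.ofReal (I.size j) ≤ processed aug I S j t})

/-- Job `j` is active (alive) at time `t`: released and not yet completed. -/
def IsActive (j : ℕ) (t : ℝ) : Prop :=
  j ∈ I.jobs ∧ I.release j ≤ t ∧ ENNReal.ofReal t < completionTime aug I S j

/-- The flow-time `F_j = C_j - r_j`. -/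
def flowTime (j : ℕ) : ℝ≥0∞ := completionTime aug I S j - ENNReal.ofReal (I.release j)

/-- Total weighted flow-time plus total energy; a machine running at speed `s` uses
power `f_i s`. -/
def cost (f : Fin m → ℝ → ℝ) : ℝ≥0∞ :=
  ∑ j ∈ I.jobs, ENNReal.ofReal (I.weight j) * flowTime aug I S j +
    ∑ i, ∫⁻ t in Set.Ici (0 : ℝ), ENNReal.ofReal (f i ((S t).speed i))

/-- A feasible schedule: nonnegative measurable speeds and shares, and the processing powers given
to the jobs on a machine never add up to more than its speed. -/
structure IsFeasible : Prop where
  measurable_machine : ∀ j ∈ I.jobs, Measurable fun t => (S t).machine j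
  measurable_share : ∀ j ∈ I.jobs, Measurable fun t => (S t).share j
  measurable_speed : ∀ i, Measurable fun t => (S t).speed i
  share_nonneg : ∀ j ∈ I.jobs, ∀ t, 0 ≤ (S t).share j
  speed_nonneg : ∀ i t, 0 ≤ (S t).speed i
  sum_share_le : ∀ i t,
    ∑ j ∈ I.jobs.filter (fun j => (S t).machine j = i), (S t).share j ≤ (S t).speed i

/-- The number of migrations of job `j`: the number of times its machine changes while it is
active, that is, the supremum of all `n` for which there are active instants
`t_0 < t_1 < ... < t_n` with the job on different machines at `t_a` and `t_{a+1}` for all `a`. -/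
def migrations (j : ℕ) : ℕ∞ :=
  ⨆ n ∈ {n : ℕ | ∃ t : Fin (n + 1) → ℝ, StrictMono t ∧ (∀ a, IsActive aug I S j (t a)) ∧
    ∀ a : Fin n, (S (t a.castSucc)).machine j ≠ (S (t a.succ)).machine j}, (n : ℕ∞)

end Run

/-- The information a non-clairvoyant online scheduler has at a given time: the time, the jobs
released so far with their release times, weights and processing rates, and the completion times
of the jobs completed so far (`∞` for the others). Job sizes are not part of it. -/
structure Observation (m : ℕ) where
  time : ℝ
  released : Finset ℕ
  release : ℕ → ℝ
  weight : ℕ → ℝ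
  rate : Fin m → ℕ → ℝ
  completion : ℕ → ℝ≥0∞

open Classical in
/-- The observation at time `t` when schedule `S` is run on instance `I`. -/
def observe {m : ℕ} (aug : ℝ) (I : JobInstance m) (S : Schedule m) (t : ℝ) : Observation m where
  time := t
  released := I.jobs.filter fun j => I.release j ≤ t
  release j := if j ∈ I.jobs ∧ I.release j ≤ t then I.release j else 0
  weight j := if j ∈ I.jobs ∧ I.release j ≤ t then I.weight j else 0
  rate i j := if j ∈ I.jobs ∧ I.release j ≤ t then I.rate i j else 0
  completion j :=
    if j ∈ I.jobs ∧ I.release j ≤ t ∧ completionTime aug I S j ≤ ENNReal.ofReal t then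
      completionTime aug I S j
    else ∞

/-- A (deterministic) non-clairvoyant online algorithm: its decision at any time is a function of
what has been observed up to that time. -/
abbrev OnlineAlgorithm (m : ℕ) := Observation m → Decision m

/-- `S` is the schedule that results when algorithm `A` is run on `I` with augmentation `aug`. -/
def IsRun {m : ℕ} (aug : ℝ) (A : OnlineAlgorithm m) (I : JobInstance m) (S : Schedule m) : Prop :=
  ∀ t, S t = A (observe aug I S t)

section SelfishMigrate

variable {m : ℕ}

/-- The virtual queues of the machines, each listed from head to tail. -/
abbrev Queues (m : ℕ) := Fin m → List ℕ

/-- The total weight of a list of jobs. -/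
def listWeight (I : JobInstance m) (l : List ℕ) : ℝ := (l.map I.weight).sum

/-- The total weight `𝒲_j` of the jobs ahead of `j` in the queue `l`. -/
def aheadWeight (I : JobInstance m) (l : List ℕ) (j : ℕ) : ℝ :=
  listWeight I (l.takeWhile fun j' => j' ≠ j)

/-- The virtual utility `g_i(x + w_j) * ℓ_{ij} / (x + w_j)` of job `j` on machine `i`, when the
total weight of the jobs ahead of it is `x`. -/
def utility (f : Fin m → ℝ → ℝ) (I : JobInstance m) (i : Fin m) (j : ℕ) (x : ℝ) : ℝ :=
  powerInv (f i) (x + I.weight j) * (I.rate i j / (x + I.weight j))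

/-- One step at time `t` of the sequential dynamics. Either a job released at `t` joins the tail of
the queue on which its virtual utility is largest, or a job migrates to the tail of the
queue that is its best response, provided this increases its virtual utility by a factor larger
than `1 + δ`. -/
inductive SelfishStep (f : Fin m → ℝ → ℝ) (I : JobInstance m) (δ t : ℝ) :
    Queues m → Queues m → Prop
  | arrive (Q : Queues m) (j : ℕ) (i : Fin m) (hj : j ∈ I.jobs) (hr : I.release j = t)
      (hnew : ∀ d, j ∉ Q d)
      (hbest : ∀ d, utility f I d j (listWeight I (Q d)) ≤ utility f I i j (listWeight I (Q i))) :
      SelfishStep f I δ t Q (Function.update Q i (Q i ++ [j]))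
  | migrate (Q : Queues m) (j : ℕ) (i d : Fin m) (hj : j ∈ Q i) (hd : d ≠ i)
      (himprove : (1 + δ) * utility f I i j (aheadWeight I (Q i) j)
        < utility f I d j (listWeight I (Q d)))
      (hbest : ∀ d', d' ≠ i →
        utility f I d' j (listWeight I (Q d')) ≤ utility f I d j (listWeight I (Q d))) :
      SelfishStep f I δ t Q
        (Function.update (Function.update Q i ((Q i).erase j)) d (Q d ++ [j]))

open Classical in
/-- `S` is a SelfishMigrate-Energy schedule for `I`, with parameter `k` of the single machine
policy, migration threshold `1 + δ` and speed augmentation `aug`. Here `Q t i` is the virtual queue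
of machine `i` at time `t`. -/
structure IsSelfishMigrateEnergy (aug : ℝ) (f : Fin m → ℝ → ℝ) (k : ℕ) (δ : ℝ)
    (I : JobInstance m) (S : Schedule m) (Q : ℝ → Queues m) : Prop where
  nodup : ∀ t i, (Q t i).Nodup
  /-- The queue of `i` holds exactly the active jobs assigned to `i`. -/
  mem_iff : ∀ t i j, j ∈ Q t i ↔ IsActive aug I S j t ∧ (S t).machine j = i
  /-- Speed scaling: the power of a machine equals the weight of the active jobs on it. -/
  power_eq : ∀ t i, 0 ≤ (S t).speed i ∧ f i ((S t).speed i) = listWeight I (Q t i)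
  /-- Weighted ranked processor sharing. -/
  share_eq : ∀ t i, ∀ j ∈ Q t i, (S t).share j =
    (S t).speed i * (((aheadWeight I (Q t i) j + I.weight j) ^ (k + 1)
      - aheadWeight I (Q t i) j ^ (k + 1)) / listWeight I (Q t i) ^ (k + 1))
  /-- No job wants to migrate: the jobs are in (approximate) Nash equilibrium. -/
  equilibrium : ∀ t i, ∀ j ∈ Q t i, ∀ d, d ≠ i →
    utility f I d j (listWeight I (Q t d))
      ≤ (1 + δ) * utility f I i j (aheadWeight I (Q t i) j)
  /-- The queues change only at isolated times `t`. There, starting from the queues `P` just before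
  `t`, the jobs completed by time `t` are deleted, and the sequential dynamics follows. -/
  dynamics : ∀ t, ∃ P : Queues m, ∃ η > 0, (∀ s, t - η < s → s < t → Q s = P) ∧
    (∀ s, t ≤ s → s < t + η → Q s = Q t) ∧
    Relation.ReflTransGen (SelfishStep f I δ t)
      (fun i => (P i).filter fun j => decide (IsActive aug I S j t)) (Q t)

end SelfishMigrate

end FlowEnergy

end

open FlowEnergy

open scoped ENNReal
open FlowEnergy

noncomputable section

namespace FlowEnergy

open MeasureTheory

/-! ### Average slopes and inverses of power functions. -/

section PowerFunction

variable {f : ℝ → ℝ}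

/-! The competitive bound is a dual fitting argument in integrated form. Write `g` for the inverse
power function of a machine, and `y` for the weight ahead of a queued job plus its own weight. The
job accumulates dual value at rate `dualRate = ν * (y / g y) / (k + 1)`. Three facts about this rate
carry the proof. It never exceeds the weight of the job (`dualRate_le_weight`). Summed over a queue,
it is at least a fraction `1 / (k + 2)` of the queue weight, because the ranked shares telescope
(`listWeight_le_sum_dualRate`). Where the job has positive utility, the rate is its unaugmented
processing rate divided by `k + 1` times that utility; so an approximate equilibrium bounds it
through the utility the job would have on any other machine (`rate_mul_dualRate_le`).

The utility of an active job never decreases: arrivals and migrations happen at tails, departures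
only shorten the weight ahead, and a migrant moves only for a gain. Hence the equilibrium inequality
at time `t` limits all dual value gained after `t` by the job size times a price that depends on the
queue weights at `t` (`rate_mul_lintegral_dualRate_le`). Averaging over the times at which a
comparison schedule processes the job bounds its dual value by weighted flow-time plus prices paid
(`dual_le`). Average slopes `x / g x` are subadditive and satisfy a Young inequality, so the prices
at one instant are controlled by the comparison weight, the queue weight and twice the comparison
energy (`sum_price_le`).

The queue weight thus reappears on the right, with factor `(k + 2) / (k + 3) < 1` by the choice of
`k`. Truncating at a finite time makes it finite, so that it can be absorbed
(`weightUntil_le_of_completed`). Since power equals queue weight, the total cost is at most twice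
the integrated weight.

Migrations are counted by the same monotonicity. Each change of machine multiplies the utility by
more than `1 + δ`, while equilibrium keeps the utility within a factor `(1 + δ) * (total weight) /
w` of its value on an empty machine.

Existence of the algorithm needs two further arguments. Equilibria are reachable because the sum of
utilities strictly increases along migrations in a finite state space
(`exists_reachable_isEquilibrium`). A run is a fixed point between announced and resulting
completion times, built by fixing the earliest unannounced completion repeatedly (`exists_isRun`).
Nothing used in a choice of queues goes beyond the observation, which contains its own past. -/

theorem IsPowerFunction.mul_le_mul (hf : IsPowerFunction f) {s t : ℝ} (hs : 0 ≤ s) (hst : s ≤ t) :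
    t * f s ≤ s * f t := by
  rcases eq_or_lt_of_le (hs.trans hst) with h | h
  · have : s = 0 := le_antisymm (h ▸ hst) hs
    simp [this, ← h]
  -- The point `s` lies on the segment from 0 to `t`, and the graph lies below the chord from the
  -- origin: average slopes increase.
  · have := hf.strictConvexOn.convexOn.2 (Set.mem_Ici.2 le_rfl) (Set.mem_Ici.2 h.le)
      (show (0 : ℝ) ≤ 1 - s / t by rw [sub_nonneg, div_le_one h]; exact hst)
      (show 0 ≤ s / t by positivity) (by ring)
    simp only [smul_eq_mul, mul_zero, zero_add, hf.map_zero] at this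
    rw [div_mul_cancel₀ _ h.ne'] at this
    calc t * f s ≤ t * (s / t * f t) := by gcongr
      _ = s * f t := by field_simp

theorem IsPowerFunction.pos (hf : IsPowerFunction f) {s : ℝ} (hs : 0 < s) : 0 < f s := by
  have := hf.strictConvexOn.2 (Set.mem_Ici.2 le_rfl) (Set.mem_Ici.2 hs.le) hs.ne
      (show (0 : ℝ) < 1 / 2 by norm_num) (show (0 : ℝ) < 1 / 2 by norm_num) (by norm_num)
  simp only [smul_eq_mul, mul_zero, zero_add, hf.map_zero] at this
  have h2 := hf.nonneg (1 / 2 * s) (by positivity)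
  linarith

theorem IsPowerFunction.monotoneOn (hf : IsPowerFunction f) : MonotoneOn f (Set.Ici 0) := by
  intro s hs t ht hst
  simp only [Set.mem_Ici] at hs ht
  rcases eq_or_lt_of_le ht with h | h
  · have : s = 0 := le_antisymm (h ▸ hst) hs
    simp [this, ← h]
  · have h1 := hf.mul_le_mul hs hst
    have h2 : s * f t ≤ t * f t := by
      have := hf.nonneg t ht
      gcongr
    exact le_of_mul_le_mul_left (h1.trans h2) h

theorem IsPowerFunction.strictMonoOn (hf : IsPowerFunction f) : StrictMonoOn f (Set.Ici 0) := by
  intro s hs t ht hst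
  simp only [Set.mem_Ici] at hs ht
  have h0 : 0 < t := hs.trans_lt hst
  have h1 := hf.mul_le_mul hs hst.le
  have h2 : s * f t < t * f t := by
    have := hf.pos h0
    gcongr
  exact lt_of_mul_lt_mul_left (h1.trans_lt h2) h0.le

theorem IsPowerFunction.exists_eq (hf : IsPowerFunction f) {x : ℝ} (hx : 0 ≤ x) :
    ∃ s ∈ Set.Ici (0 : ℝ), f s = x := by
  rcases eq_or_lt_of_le hx with h | h
  · exact ⟨0, Set.mem_Ici.2 le_rfl, by rw [hf.map_zero, h]⟩
  have h1 : 0 < f 1 := hf.pos one_pos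
  -- Comparing with the ray through `(1, f 1)` brackets `x`. The left end `a` is positive, so
  -- continuity of a convex function in the interior suffices.
  set a := min 1 (x / f 1)
  set b := max 1 (x / f 1)
  have ha : 0 < a := lt_min one_pos (div_pos h h1)
  have hfa : f a ≤ x := by
    have := hf.mul_le_mul ha.le (min_le_left _ _)
    calc f a ≤ a * f 1 := by linarith
      _ ≤ x / f 1 * f 1 := by gcongr; exact min_le_right _ _
      _ = x := div_mul_cancel₀ _ h1.ne'
  have hfb : x ≤ f b := by
    have := hf.mul_le_mul zero_le_one (le_max_left 1 (x / f 1))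
    calc x = x / f 1 * f 1 := (div_mul_cancel₀ _ h1.ne').symm
      _ ≤ b * f 1 := by gcongr; exact le_max_right _ _
      _ ≤ f b := by linarith
  have hab : a ≤ b := (min_le_left _ _).trans (le_max_left _ _)
  have hc : ContinuousOn f (Set.Icc a b) := by
    have := hf.strictConvexOn.convexOn.continuousOn_interior
    rw [interior_Ici] at this
    exact this.mono fun y hy => lt_of_lt_of_le ha hy.1
  obtain ⟨s, hs, rfl⟩ := intermediate_value_Icc hab hc ⟨hfa, hfb⟩
  exact ⟨s, ha.le.trans hs.1, rfl⟩

theorem IsPowerFunction.powerInv_nonneg (hf : IsPowerFunction f) {x : ℝ} (hx : 0 ≤ x) :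
    0 ≤ powerInv f x :=
  Function.invFunOn_mem (hf.exists_eq hx)

theorem IsPowerFunction.apply_powerInv (hf : IsPowerFunction f) {x : ℝ} (hx : 0 ≤ x) :
    f (powerInv f x) = x :=
  Function.invFunOn_eq (hf.exists_eq hx)

theorem IsPowerFunction.powerInv_pos (hf : IsPowerFunction f) {x : ℝ} (hx : 0 < x) :
    0 < powerInv f x := by
  refine lt_of_le_of_ne (hf.powerInv_nonneg hx.le) fun h => hx.ne ?_
  rw [← hf.apply_powerInv hx.le, ← h, hf.map_zero]

theorem IsPowerFunction.powerInv_mono (hf : IsPowerFunction f) {x y : ℝ} (hx : 0 ≤ x)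
    (hxy : x ≤ y) : powerInv f x ≤ powerInv f y := by
  rw [← hf.strictMonoOn.le_iff_le (hf.powerInv_nonneg hx) (hf.powerInv_nonneg (hx.trans hxy)),
    hf.apply_powerInv hx, hf.apply_powerInv (hx.trans hxy)]
  exact hxy

/-- The map `x ↦ x / g x` is increasing. -/
theorem IsPowerFunction.div_powerInv_mono (hf : IsPowerFunction f) {x y : ℝ} (hx : 0 < x)
    (hxy : x ≤ y) : x / powerInv f x ≤ y / powerInv f y := by
  have hy := hx.trans_le hxy
  rw [div_le_div_iff₀ (hf.powerInv_pos hx) (hf.powerInv_pos hy)]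
  have := hf.mul_le_mul (hf.powerInv_nonneg hx.le) (hf.powerInv_mono hx.le hxy)
  rw [hf.apply_powerInv hx.le, hf.apply_powerInv hy.le] at this
  linarith

theorem IsPowerFunction.powerInv_div_anti (hf : IsPowerFunction f) {x y : ℝ} (hx : 0 < x)
    (hxy : x ≤ y) : powerInv f y / y ≤ powerInv f x / x := by
  have hy := hx.trans_le hxy
  have := hf.div_powerInv_mono hx hxy
  rw [div_le_div_iff₀ (hf.powerInv_pos hx) (hf.powerInv_pos hy)] at this
  rw [div_le_div_iff₀ hy hx]
  linarith

/-- The map `x ↦ x / g x` is subadditive. -/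
theorem IsPowerFunction.add_div_powerInv_le (hf : IsPowerFunction f) {x w : ℝ} (hx : 0 ≤ x)
    (hw : 0 < w) :
    (x + w) / powerInv f (x + w) ≤ x / powerInv f x + w / powerInv f w := by
  rw [add_div]
  have h2 : w / powerInv f (x + w) ≤ w / powerInv f w :=
    div_le_div_of_nonneg_left hw.le (hf.powerInv_pos hw) (hf.powerInv_mono hw.le (by linarith))
  rcases eq_or_lt_of_le hx with h | h
  · subst h; simp
  · have h1 : x / powerInv f (x + w) ≤ x / powerInv f x :=
      div_le_div_of_nonneg_left hx (hf.powerInv_pos h) (hf.powerInv_mono hx (by linarith))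
    linarith

/-- A Young type inequality for the average slope `x / g x`. -/
theorem IsPowerFunction.div_powerInv_mul_le (hf : IsPowerFunction f) {x s : ℝ} (hx : 0 ≤ x)
    (hs : 0 ≤ s) : x / powerInv f x * s ≤ x + f s := by
  have hfs := hf.nonneg s hs
  rcases eq_or_lt_of_le hx with h | h
  · subst h; simpa using hfs
  have hg := hf.powerInv_pos h
  rw [div_mul_eq_mul_div, div_le_iff₀ hg]
  -- Below `g x` the left side is at most `x`; above it, the average slope at `g x` is at most that
  -- at `s`, and the left side is at most `f s`.
  rcases le_total s (powerInv f x) with h1 | h1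
  · nlinarith
  · have := hf.mul_le_mul hg.le h1
    rw [hf.apply_powerInv hx] at this
    nlinarith

/-- Every `a i` is at most `x`, so its average slope is at most that of `x`. This superadditivity
bounds the energy charged to single jobs by the energy of their machine. -/
theorem IsPowerFunction.sum_le (hf : IsPowerFunction f) {ι : Type*} (s : Finset ι) {a : ι → ℝ}
    {x : ℝ} (ha : ∀ i ∈ s, 0 ≤ a i) (hx : ∑ i ∈ s, a i ≤ x) : ∑ i ∈ s, f (a i) ≤ f x := by
  have h0 : 0 ≤ x := (Finset.sum_nonneg ha).trans hx
  rcases eq_or_lt_of_le h0 with h | h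
  · have h1 : ∀ i ∈ s, a i = 0 := by
      refine (Finset.sum_eq_zero_iff_of_nonneg ha).1 (le_antisymm (h ▸ hx) (Finset.sum_nonneg ha))
    rw [Finset.sum_congr rfl fun i hi => by rw [h1 i hi, hf.map_zero]]
    simpa using hf.nonneg x h0
  · refine le_of_mul_le_mul_left ?_ h
    rw [Finset.mul_sum]
    calc ∑ i ∈ s, x * f (a i) ≤ ∑ i ∈ s, a i * f x :=
          Finset.sum_le_sum fun i hi => hf.mul_le_mul (ha i hi)
            ((Finset.single_le_sum ha hi).trans hx)
      _ = (∑ i ∈ s, a i) * f x := by rw [Finset.sum_mul]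
      _ ≤ x * f x := by
        have := hf.nonneg x h0
        gcongr

/-- Negative arguments are unconstrained, so `f` itself need not be measurable; precomposing with
`max 0` gives a monotone function. -/
theorem IsPowerFunction.measurable_comp (hf : IsPowerFunction f) {α : Type*} [MeasurableSpace α]
    {u : α → ℝ} (hu : Measurable u) (hu0 : ∀ a, 0 ≤ u a) : Measurable fun a => f (u a) := by
  have hm : Monotone fun x => f (max 0 x) := fun x y hxy =>
    hf.monotoneOn (Set.mem_Ici.2 (le_max_left _ _)) (Set.mem_Ici.2 (le_max_left _ _))
      (max_le_max le_rfl hxy)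
  have := hm.measurable.comp hu
  simpa [Function.comp_def, max_eq_right (hu0 _)] using this

end PowerFunction

/-- This is `∫ s d(s ^ (k + 1)) ≤ y * ∫ d(s ^ (k + 1))` over `[x, y]`, up to constants. It turns the
shares, weighted by `y`, into a telescoping sum of powers of degree `k + 2`. -/
theorem pow_succ_sub_mul_le (k : ℕ) {x y : ℝ} (hx : 0 ≤ x) (hxy : x ≤ y) :
    ((k : ℝ) + 1) * (y ^ (k + 2) - x ^ (k + 2)) ≤
      ((k : ℝ) + 2) * ((y ^ (k + 1) - x ^ (k + 1)) * y) := by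
  have hy := hx.trans hxy
  induction k with
  | zero => norm_num; nlinarith [sq_nonneg (y - x)]
  | succ k ih =>
    push_cast at ih ⊢
    have h1 : x ^ (k + 1) ≤ y ^ (k + 1) := by gcongr
    have h2 : 0 ≤ x ^ (k + 1) := by positivity
    have e1 : y ^ (k + 1 + 2) = y ^ (k + 1) * y ^ 2 := by ring
    have e2 : x ^ (k + 1 + 2) = x ^ (k + 1) * x ^ 2 := by ring
    have e3 : y ^ (k + 1 + 1) = y ^ (k + 1) * y := by ring
    have e4 : x ^ (k + 1 + 1) = x ^ (k + 1) * x := by ring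
    have e5 : y ^ (k + 2) = y ^ (k + 1) * y := by ring
    have e6 : x ^ (k + 2) = x ^ (k + 1) * x := by ring
    rw [e5, e6] at ih
    rw [e1, e2, e3, e4]
    have ih2 := mul_le_mul_of_nonneg_left ih hx
    have ih3 := mul_nonneg (mul_nonneg hy (sub_nonneg.2 hxy)) (sub_nonneg.2 h1)
    have h3 : 0 ≤ (k + 2 : ℝ) * (x ^ (k + 1) * (y - x) ^ 2) := by positivity
    have h4 : 0 ≤ y ^ (k + 1) * (y - x) ^ 2 := by positivity
    nlinarith

theorem pow_succ_sub_le (k : ℕ) {x y : ℝ} (hx : 0 ≤ x) (hxy : x ≤ y) :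
    y ^ (k + 1) - x ^ (k + 1) ≤ ((k : ℝ) + 1) * ((y - x) * y ^ k) := by
  have hy := hx.trans hxy
  induction k with
  | zero => simp
  | succ k ih =>
    push_cast
    have h1 : x ^ (k + 1) ≤ y ^ (k + 1) := by gcongr
    have e3 : y ^ (k + 1 + 1) = y ^ (k + 1) * y := by ring
    have e4 : x ^ (k + 1 + 1) = x ^ (k + 1) * x := by ring
    rw [e3, e4]
    have h6 : y * (y ^ (k + 1) - x ^ (k + 1)) ≤ (k + 1 : ℝ) * ((y - x) * y ^ (k + 1)) :=
      (mul_le_mul_of_nonneg_left ih hy).trans_eq (by ring)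
    have h5 := mul_nonneg (sub_nonneg.2 hxy) (sub_nonneg.2 h1)
    nlinarith

/-! ### Queue weights and virtual utilities. -/

section Weight

variable {m : ℕ} (I : JobInstance m)

theorem listWeight_append (l l' : List ℕ) :
    listWeight I (l ++ l') = listWeight I l + listWeight I l' := by
  simp [listWeight]

theorem listWeight_singleton (j : ℕ) : listWeight I [j] = I.weight j := by
  simp [listWeight]

variable {I}

theorem listWeight_nonneg {l : List ℕ} (hl : ∀ j ∈ l, j ∈ I.jobs) : 0 ≤ listWeight I l := by
  refine List.sum_nonneg fun x hx => ?_
  obtain ⟨j, hj, rfl⟩ := List.mem_map.1 hx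
  exact (I.weight_pos j (hl j hj)).le

theorem listWeight_le_of_sublist {l l' : List ℕ} (h : l.Sublist l') (hl : ∀ j ∈ l', j ∈ I.jobs) :
    listWeight I l ≤ listWeight I l' := by
  refine List.Sublist.sum_le_sum (h.map _) fun x hx => ?_
  obtain ⟨j, hj, rfl⟩ := List.mem_map.1 hx
  exact (I.weight_pos j (hl j hj)).le

theorem listWeight_eq_sum {l : List ℕ} (hl : l.Nodup) :
    listWeight I l = ∑ j ∈ l.toFinset, I.weight j := by
  rw [listWeight, List.sum_toFinset _ hl]

theorem listWeight_le_sum {l : List ℕ} (hn : l.Nodup) (hl : ∀ j ∈ l, j ∈ I.jobs) :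
    listWeight I l ≤ ∑ j ∈ I.jobs, I.weight j := by
  rw [listWeight_eq_sum hn]
  exact Finset.sum_le_sum_of_subset_of_nonneg (fun j hj => hl j (List.mem_toFinset.1 hj))
    fun j hj _ => (I.weight_pos j hj).le

theorem aheadWeight_append_of_mem {l : List ℕ} (l' : List ℕ) {j : ℕ} (hj : j ∈ l) :
    aheadWeight I (l ++ l') j = aheadWeight I l j := by
  unfold aheadWeight
  congr 1
  induction l with
  | nil => simp at hj
  | cons a l ih =>
    by_cases h : a = j
    · simp [h]
    · have : j ∈ l := by
        rcases List.mem_cons.1 hj with h' | h'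
        · exact absurd h'.symm h
        · exact h'
      simpa [h] using ih this

theorem aheadWeight_append_self {l : List ℕ} {j : ℕ} (hj : j ∉ l) :
    aheadWeight I (l ++ [j]) j = listWeight I l := by
  unfold aheadWeight
  congr 1
  rw [List.takeWhile_append_of_pos]
  · simp
  · intro a ha
    simpa using fun h : a = j => hj (h ▸ ha)

theorem aheadWeight_nonneg {l : List ℕ} (hl : ∀ j ∈ l, j ∈ I.jobs) (j : ℕ) :
    0 ≤ aheadWeight I l j :=
  listWeight_nonneg fun a ha => hl a ((List.takeWhile_sublist _).subset ha)

theorem aheadWeight_filter_le {l : List ℕ} (hl : ∀ j ∈ l, j ∈ I.jobs) (p : ℕ → Bool) {j : ℕ}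
    (hj : p j = true) : aheadWeight I (l.filter p) j ≤ aheadWeight I l j := by
  refine listWeight_le_of_sublist ?_ fun a ha => hl a ((List.takeWhile_sublist _).subset ha)
  clear hl
  induction l with
  | nil => simp
  | cons a l ih =>
    by_cases ha : a = j
    · simp [ha, hj]
    · by_cases hp : p a = true
      · simpa [ha, hp] using ih
      · simpa [ha, hp] using ih.trans (List.sublist_cons_self _ _)

theorem aheadWeight_add_le {l : List ℕ} (hl : ∀ j ∈ l, j ∈ I.jobs) {j : ℕ} (hj : j ∈ l) :
    aheadWeight I l j + I.weight j ≤ listWeight I l := by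
  induction l with
  | nil => simp at hj
  | cons a l ih =>
    have hl' : ∀ j ∈ l, j ∈ I.jobs := fun b hb => hl b (List.mem_cons_of_mem _ hb)
    by_cases ha : a = j
    · subst ha
      simpa [aheadWeight, listWeight] using listWeight_nonneg hl'
    · have hj' : j ∈ l := by
        rcases List.mem_cons.1 hj with h' | h'
        · exact absurd h'.symm ha
        · exact h'
      have := ih hl' hj'
      simp only [aheadWeight, listWeight] at this
      simp only [aheadWeight, listWeight, ha, ne_eq, not_false_eq_true, decide_true,
        List.takeWhile_cons_of_pos, List.map_cons, List.sum_cons]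
      linarith

/-- Telescoping along a queue. -/
theorem sum_ahead_telescope (Ψ : ℝ → ℝ) {l : List ℕ} (hl : l.Nodup) :
    ∑ j ∈ l.toFinset, (Ψ (aheadWeight I l j + I.weight j) - Ψ (aheadWeight I l j)) =
      Ψ (listWeight I l) - Ψ 0 := by
  induction l using List.reverseRecOn with
  | nil => simp [listWeight]
  | append_singleton l j ih =>
    have hj : j ∉ l := fun h => (List.nodup_append.1 hl).2.2 j h j (by simp) rfl
    have hl' := (List.nodup_append.1 hl).1
    have : (l ++ [j]).toFinset = insert j l.toFinset := by ext; simp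
    rw [this, Finset.sum_insert (by simpa using hj), aheadWeight_append_self hj,
      listWeight_append, listWeight_singleton]
    rw [Finset.sum_congr rfl fun a ha => by
      rw [aheadWeight_append_of_mem [j] (List.mem_toFinset.1 ha)], ih hl']
    ring

/-- Needed to pass between instances that are indistinguishable to the scheduler so far. -/
theorem listWeight_congr {I' : JobInstance m} {l : List ℕ}
    (h : ∀ j ∈ l, I.weight j = I'.weight j) : listWeight I l = listWeight I' l := by
  unfold listWeight
  rw [List.map_congr_left h]

theorem aheadWeight_congr {I' : JobInstance m} {l : List ℕ}
    (h : ∀ j ∈ l, I.weight j = I'.weight j) (j : ℕ) : aheadWeight I l j = aheadWeight I' l j :=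
  listWeight_congr fun a ha => h a ((List.takeWhile_sublist _).subset ha)

theorem utility_congr {f : Fin m → ℝ → ℝ} {I' : JobInstance m} {i : Fin m} {j : ℕ}
    (hw : I.weight j = I'.weight j) (hr : I.rate i j = I'.rate i j) (x : ℝ) :
    utility f I i j x = utility f I' i j x := by
  simp [utility, hw, hr]

theorem utility_nonneg {f : Fin m → ℝ → ℝ} (hf : ∀ i, IsPowerFunction (f i)) (i : Fin m) {j : ℕ}
    (hj : j ∈ I.jobs) {x : ℝ} (hx : 0 ≤ x) : 0 ≤ utility f I i j x := by
  have hw := I.weight_pos j hj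
  have := (hf i).powerInv_nonneg (add_nonneg hx hw.le)
  have := I.rate_nonneg i j hj
  unfold utility
  positivity

/-- The utility is the rate times `g y / y` at `y = x + w`, and this quotient decreases. -/
theorem utility_anti {f : Fin m → ℝ → ℝ} (hf : ∀ i, IsPowerFunction (f i)) (i : Fin m) {j : ℕ}
    (hj : j ∈ I.jobs) {x y : ℝ} (hx : 0 ≤ x) (hxy : x ≤ y) :
    utility f I i j y ≤ utility f I i j x := by
  have hw := I.weight_pos j hj
  have h := (hf i).powerInv_div_anti (x := x + I.weight j) (y := y + I.weight j) (by linarith)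
    (by linarith)
  have hr := I.rate_nonneg i j hj
  unfold utility
  rw [mul_div_left_comm, mul_div_left_comm (powerInv (f i) (x + I.weight j))]
  gcongr

end Weight

/-! ### Queue states, migration steps and equilibria. -/

section State

variable {m : ℕ}

/-- A job is in one of the queues. -/
def Queued (Q : Queues m) (j : ℕ) : Prop := ∃ i, j ∈ Q i

/-- The queues hold jobs of the instance, each at most once. -/
structure ValidQueues (I : JobInstance m) (Q : Queues m) : Prop where
  nodup : ∀ i, (Q i).Nodup
  inj : ∀ {i d j}, j ∈ Q i → j ∈ Q d → i = d
  mem_jobs : ∀ {i j}, j ∈ Q i → j ∈ I.jobs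

theorem ValidQueues.filter {I : JobInstance m} {Q : Queues m} (hQ : ValidQueues I Q)
    (p : ℕ → Bool) : ValidQueues I (fun i => (Q i).filter p) where
  nodup i := (hQ.nodup i).filter _
  inj h h' := hQ.inj (List.mem_filter.1 h).1 (List.mem_filter.1 h').1
  mem_jobs h := hQ.mem_jobs (List.mem_filter.1 h).1

/-- Finiteness allows a maximum of the potential over reachable states, in place of a termination
argument. -/
theorem finite_validQueues (I : JobInstance m) : {Q : Queues m | ValidQueues I Q}.Finite := by
  have hfin : {l : List ℕ | l.Nodup ∧ ∀ j ∈ l, j ∈ I.jobs}.Finite := by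
    refine (I.jobs.powerset.biUnion fun s => s.toList.permutations.toFinset).finite_toSet.subset
      fun l hl => ?_
    simp only [Finset.coe_biUnion, Set.mem_iUnion, Finset.mem_coe, List.mem_toFinset,
      List.mem_permutations, Finset.mem_powerset]
    refine ⟨l.toFinset, fun j hj => hl.2 j (List.mem_toFinset.1 hj), ?_⟩
    exact (List.toFinset_toList hl.1).symm
  exact (Set.Finite.pi' fun _ : Fin m => hfin).subset fun Q hQ i =>
    ⟨hQ.nodup i, fun j hj => hQ.mem_jobs hj⟩

variable {f : Fin m → ℝ → ℝ} {I : JobInstance m} {δ t : ℝ} {Q Q' : Queues m}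

theorem ValidQueues.arrive (hQ : ValidQueues I Q) {i : Fin m} {j : ℕ} (hj : j ∈ I.jobs)
    (hnew : ∀ d, j ∉ Q d) : ValidQueues I (Function.update Q i (Q i ++ [j])) := by
  have key : ∀ {d a}, a ∈ Function.update Q i (Q i ++ [j]) d → a ∈ Q d ∨ (a = j ∧ d = i) := by
    intro d a h
    by_cases hd : d = i
    · subst hd; simpa using h
    · rw [Function.update_of_ne hd] at h; exact Or.inl h
  refine ⟨fun d => ?_, fun {d d' a} h h' => ?_, fun {d a} h => ?_⟩
  · by_cases hd : d = i
    · subst hd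
      rw [Function.update_self]
      exact (hQ.nodup d).append (List.nodup_singleton j) (by simpa using hnew d)
    · rw [Function.update_of_ne hd]; exact hQ.nodup d
  · rcases key h with h1 | ⟨h1, h2⟩ <;> rcases key h' with h3 | ⟨h3, h4⟩
    · exact hQ.inj h1 h3
    · exact absurd (h3 ▸ h1) (hnew d)
    · exact absurd (h1 ▸ h3) (hnew d')
    · exact h2.trans h4.symm
  · rcases key h with h1 | ⟨h1, -⟩
    · exact hQ.mem_jobs h1
    · exact h1 ▸ hj

/-- A job occurs at most once overall, so removing it from its queue is a filter on all queues. A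
migration thereby becomes a deletion followed by an arrival, and inherits the properties of both. -/
theorem ValidQueues.erase (hQ : ValidQueues I Q) (i : Fin m) {j : ℕ} (hj : j ∈ Q i) :
    Function.update Q i ((Q i).erase j) = fun d => (Q d).filter fun a => decide (a ≠ j) := by
  funext d
  by_cases hd : d = i
  · subst hd
    rw [Function.update_self, (hQ.nodup d).erase_eq_filter]
    congr 1
    ext a
    by_cases h : a = j <;> simp [h]
  · rw [Function.update_of_ne hd, eq_comm, List.filter_eq_self]
    intro a ha
    exact decide_eq_true fun h => hd (hQ.inj ha (h ▸ hj))

theorem queued_arrive {i : Fin m} {j a : ℕ} :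
    Queued (Function.update Q i (Q i ++ [j])) a ↔ Queued Q a ∨ a = j := by
  constructor
  · rintro ⟨d, h⟩
    by_cases hd : d = i
    · subst hd
      rw [Function.update_self, List.mem_append, List.mem_singleton] at h
      exact h.imp (fun h => ⟨d, h⟩) id
    · rw [Function.update_of_ne hd] at h; exact Or.inl ⟨d, h⟩
  · rintro (⟨d, h⟩ | rfl)
    · refine ⟨d, ?_⟩
      by_cases hd : d = i
      · subst hd; simp [h]
      · rwa [Function.update_of_ne hd]
    · exact ⟨i, by simp⟩

theorem ValidQueues.migrate_eq (hQ : ValidQueues I Q) {i d : Fin m} {j : ℕ} (hj : j ∈ Q i)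
    (hd : d ≠ i) :
    Function.update (Function.update Q i ((Q i).erase j)) d (Q d ++ [j]) =
      Function.update (fun d => (Q d).filter fun a => decide (a ≠ j)) d
        ((Q d).filter (fun a => decide (a ≠ j)) ++ [j]) := by
  rw [hQ.erase i hj]
  congr 2
  rw [eq_comm, List.filter_eq_self]
  intro a ha
  exact decide_eq_true fun h => hd (hQ.inj ha (h ▸ hj))

theorem ValidQueues.migrate (hQ : ValidQueues I Q) {i d : Fin m} {j : ℕ} (hj : j ∈ Q i)
    (hd : d ≠ i) :
    ValidQueues I (Function.update (Function.update Q i ((Q i).erase j)) d (Q d ++ [j])) := by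
  rw [hQ.migrate_eq hj hd]
  exact (hQ.filter _).arrive (hQ.mem_jobs hj) (by simp)

theorem ValidQueues.queued_migrate (hQ : ValidQueues I Q) {i d : Fin m} {j a : ℕ} (hj : j ∈ Q i)
    (hd : d ≠ i) :
    Queued (Function.update (Function.update Q i ((Q i).erase j)) d (Q d ++ [j])) a ↔
      Queued Q a := by
  rw [hQ.migrate_eq hj hd]
  have := queued_arrive (Q := fun d => (Q d).filter fun a => decide (a ≠ j)) (i := d) (j := j)
    (a := a)
  rw [this]
  by_cases h : a = j
  · subst h; simp [Queued]; exact ⟨i, hj⟩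
  · simp [Queued, h]

/-- No job can multiply its utility by more than `1 + δ` by moving to the tail of another queue. -/
def IsEquilibrium (f : Fin m → ℝ → ℝ) (I : JobInstance m) (δ : ℝ) (Q : Queues m) : Prop :=
  ∀ i, ∀ j ∈ Q i, ∀ d, d ≠ i →
    utility f I d j (listWeight I (Q d)) ≤ (1 + δ) * utility f I i j (aheadWeight I (Q i) j)

/-- The information available at time `t` about `I'` is also valid for `I`. -/
def AgreeUntil (t : ℝ) (I' I : JobInstance m) : Prop :=
  ∀ j ∈ I'.jobs, I'.release j ≤ t → j ∈ I.jobs ∧ I.release j = I'.release j ∧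
    I'.weight j = I.weight j ∧ ∀ i, I'.rate i j = I.rate i j

/-- A step reads only weights and rates of the moving job and of queued jobs. Carrying along that
queued jobs are already released makes all of these visible, and the argument can be iterated. -/
theorem AgreeUntil.selfishStep {I' : JobInstance m} (hI : AgreeUntil t I' I)
    (hQ : ∀ j, Queued Q j → j ∈ I'.jobs ∧ I'.release j ≤ t) (h : SelfishStep f I' δ t Q Q') :
    SelfishStep f I δ t Q Q' ∧ ∀ j, Queued Q' j → j ∈ I'.jobs ∧ I'.release j ≤ t := by
  have hA : ∀ {j d}, j ∈ Q d → I'.weight j = I.weight j := fun {j d} h =>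
    (hI j (hQ j ⟨d, h⟩).1 (hQ j ⟨d, h⟩).2).2.2.1
  have hW : ∀ d, listWeight I' (Q d) = listWeight I (Q d) := fun d =>
    listWeight_congr fun j hj => hA hj
  cases h with
  | arrive j i hj hr hnew hbest =>
    obtain ⟨h1, h2, h3, h4⟩ := hI j hj hr.le
    refine ⟨.arrive Q j i h1 (h2.trans hr) hnew fun d => ?_, fun a ha => ?_⟩
    · have := hbest d
      rwa [hW, hW, utility_congr h3 (h4 _), utility_congr h3 (h4 _)] at this
    · obtain ⟨d, hd⟩ := ha
      by_cases hdi : d = i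
      · subst hdi
        rw [Function.update_self, List.mem_append, List.mem_singleton] at hd
        rcases hd with hd | rfl
        · exact hQ a ⟨d, hd⟩
        · exact ⟨hj, hr.le⟩
      · rw [Function.update_of_ne hdi] at hd; exact hQ a ⟨d, hd⟩
  | migrate j i d hj hd himprove hbest =>
    obtain ⟨h1, h2⟩ := hQ j ⟨i, hj⟩
    obtain ⟨-, -, h3, h4⟩ := hI j h1 h2
    refine ⟨.migrate Q j i d hj hd ?_ fun d' hd' => ?_, fun a ha => ?_⟩
    · rwa [hW, utility_congr h3 (h4 _), utility_congr h3 (h4 _),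
        aheadWeight_congr fun a ha => hA ha] at himprove
    · have := hbest d' hd'
      rwa [hW, hW, utility_congr h3 (h4 _), utility_congr h3 (h4 _)] at this
    · obtain ⟨e, he⟩ := ha
      by_cases hed : e = d
      · subst hed
        rw [Function.update_self, List.mem_append, List.mem_singleton] at he
        rcases he with he | rfl
        · exact hQ a ⟨e, he⟩
        · exact hQ a ⟨i, hj⟩
      · rw [Function.update_of_ne hed] at he
        by_cases hei : e = i
        · subst hei
          rw [Function.update_self] at he
          exact hQ a ⟨e, List.mem_of_mem_erase he⟩
        · rw [Function.update_of_ne hei] at he; exact hQ a ⟨e, he⟩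

theorem AgreeUntil.reflTransGen {I' : JobInstance m} (hI : AgreeUntil t I' I)
    (hQ : ∀ j, Queued Q j → j ∈ I'.jobs ∧ I'.release j ≤ t)
    (h : Relation.ReflTransGen (SelfishStep f I' δ t) Q Q') :
    Relation.ReflTransGen (SelfishStep f I δ t) Q Q' ∧
      ∀ j, Queued Q' j → j ∈ I'.jobs ∧ I'.release j ≤ t := by
  induction h with
  | refl => exact ⟨.refl, hQ⟩
  | tail _ hstep ih =>
    have := hI.selfishStep ih.2 hstep
    exact ⟨ih.1.tail this.1, this.2⟩

theorem AgreeUntil.isEquilibrium {I' : JobInstance m} (hI : AgreeUntil t I' I)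
    (hQ : ∀ j, Queued Q j → j ∈ I'.jobs ∧ I'.release j ≤ t)
    (h : IsEquilibrium f I' δ Q) : IsEquilibrium f I δ Q := by
  have hA : ∀ {j d}, j ∈ Q d → I'.weight j = I.weight j := fun {j d} h =>
    (hI j (hQ j ⟨d, h⟩).1 (hQ j ⟨d, h⟩).2).2.2.1
  intro i j hj d hd
  obtain ⟨-, -, h3, h4⟩ := hI j (hQ j ⟨i, hj⟩).1 (hQ j ⟨i, hj⟩).2
  have := h i j hj d hd
  rwa [utility_congr h3 (h4 _), utility_congr h3 (h4 _), aheadWeight_congr fun a ha => hA ha,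
    listWeight_congr fun a ha => hA ha] at this

variable [Nonempty (Fin m)]

/-- The machine of a queued job. -/
def machineOf (Q : Queues m) (j : ℕ) : Fin m := Classical.epsilon fun i => j ∈ Q i

theorem mem_machineOf {Q : Queues m} {j : ℕ} (h : Queued Q j) : j ∈ Q (machineOf Q j) :=
  Classical.epsilon_spec h

theorem ValidQueues.machineOf_eq {I : JobInstance m} {Q : Queues m} (hQ : ValidQueues I Q)
    {i : Fin m} {j : ℕ} (h : j ∈ Q i) : machineOf Q j = i :=
  hQ.inj (mem_machineOf ⟨i, h⟩) h

/-- The virtual utility of a queued job at its current position. -/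
def jobUtility (f : Fin m → ℝ → ℝ) (I : JobInstance m) (Q : Queues m) (j : ℕ) : ℝ :=
  utility f I (machineOf Q j) j (aheadWeight I (Q (machineOf Q j)) j)

theorem jobUtility_eq (hQ : ValidQueues I Q) {i : Fin m} {j : ℕ} (h : j ∈ Q i) :
    jobUtility f I Q j = utility f I i j (aheadWeight I (Q i) j) := by
  rw [jobUtility, hQ.machineOf_eq h]

theorem jobUtility_nonneg (hf : ∀ i, IsPowerFunction (f i)) (hQ : ValidQueues I Q) {j : ℕ}
    (h : Queued Q j) : 0 ≤ jobUtility f I Q j := by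
  obtain ⟨i, hi⟩ := h
  rw [jobUtility_eq hQ hi]
  exact utility_nonneg hf _ (hQ.mem_jobs hi) (aheadWeight_nonneg (fun a ha => hQ.mem_jobs ha) _)

/-- From `Q` to `Q'` job `j` does not lose utility, and it gains by a factor larger than `1 + δ`
if its machine changes. -/
def ImprovesFor (f : Fin m → ℝ → ℝ) (I : JobInstance m) (δ : ℝ) (Q Q' : Queues m) (j : ℕ) : Prop :=
  jobUtility f I Q j ≤ jobUtility f I Q' j ∧
    (machineOf Q j ≠ machineOf Q' j → (1 + δ) * jobUtility f I Q j < jobUtility f I Q' j)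

theorem ImprovesFor.refl (Q : Queues m) (j : ℕ) : ImprovesFor f I δ Q Q j :=
  ⟨le_rfl, fun h => absurd rfl h⟩

theorem ImprovesFor.trans {Q₁ Q₂ Q₃ : Queues m} {j : ℕ} (hδ : 0 ≤ δ)
    (h : ImprovesFor f I δ Q₁ Q₂ j) (h' : ImprovesFor f I δ Q₂ Q₃ j) :
    ImprovesFor f I δ Q₁ Q₃ j := by
  refine ⟨h.1.trans h'.1, fun hne => ?_⟩
  -- If the end machines differ, one of the two stages changes the machine and supplies the factor;
  -- the other does not lose utility.
  by_cases h1 : machineOf Q₁ j = machineOf Q₂ j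
  · refine lt_of_le_of_lt ?_ (h'.2 fun h2 => hne (h1.trans h2))
    exact mul_le_mul_of_nonneg_left h.1 (by linarith)
  · exact (h.2 h1).trans_le h'.1

theorem improvesFor_of_mem (hQ : ValidQueues I Q) (hQ' : ValidQueues I Q')
    (hf : ∀ i, IsPowerFunction (f i)) {i : Fin m} {j : ℕ} (h : j ∈ Q i) (h' : j ∈ Q' i)
    (ha : aheadWeight I (Q' i) j ≤ aheadWeight I (Q i) j) : ImprovesFor f I δ Q Q' j := by
  refine ⟨?_, fun hne => absurd ?_ hne⟩
  · rw [jobUtility_eq hQ h, jobUtility_eq hQ' h']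
    exact utility_anti hf _ (hQ.mem_jobs h) (aheadWeight_nonneg (fun a ha => hQ'.mem_jobs ha) _) ha
  · rw [hQ.machineOf_eq h, hQ'.machineOf_eq h']

theorem ValidQueues.improvesFor_filter (hQ : ValidQueues I Q) (hf : ∀ i, IsPowerFunction (f i))
    {p : ℕ → Bool} {j : ℕ} (h : Queued Q j) (hp : p j = true) :
    Queued (fun i => (Q i).filter p) j ∧
      ImprovesFor f I δ Q (fun i => (Q i).filter p) j := by
  obtain ⟨i, hi⟩ := h
  have hi' : j ∈ (Q i).filter p := List.mem_filter.2 ⟨hi, hp⟩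
  exact ⟨⟨i, hi'⟩, improvesFor_of_mem hQ (hQ.filter p) hf hi hi'
    (aheadWeight_filter_le (fun a ha => hQ.mem_jobs ha) p hp)⟩

/-- Effect of adding a job at the tail of a queue on the other jobs. -/
theorem ValidQueues.improvesFor_arrive (hQ : ValidQueues I Q) (hf : ∀ i, IsPowerFunction (f i))
    {i : Fin m} {j a : ℕ} (hj : j ∈ I.jobs) (hnew : ∀ d, j ∉ Q d) (h : Queued Q a) :
    Queued (Function.update Q i (Q i ++ [j])) a ∧
      ImprovesFor f I δ Q (Function.update Q i (Q i ++ [j])) a := by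
  obtain ⟨d, hd⟩ := h
  have hd' : a ∈ Function.update Q i (Q i ++ [j]) d := by
    by_cases h : d = i
    · subst h; simp [hd]
    · rwa [Function.update_of_ne h]
  refine ⟨⟨d, hd'⟩, improvesFor_of_mem hQ (hQ.arrive hj hnew) hf hd hd' ?_⟩
  by_cases h : d = i
  · subst h
    rw [Function.update_self, aheadWeight_append_of_mem _ hd]
  · rw [Function.update_of_ne h]

/-- A newcomer stands behind everybody, and a departure only reduces the weight ahead of those who
stay. The migrant gains by the rule for migrating. -/
theorem SelfishStep.improves (hf : ∀ i, IsPowerFunction (f i)) (hδ : 0 ≤ δ)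
    (hQ : ValidQueues I Q) (h : SelfishStep f I δ t Q Q') :
    ValidQueues I Q' ∧ ∀ j, Queued Q j → Queued Q' j ∧ ImprovesFor f I δ Q Q' j := by
  cases h with
  | arrive j i hj hr hnew hbest =>
    exact ⟨hQ.arrive hj hnew, fun a ha => hQ.improvesFor_arrive hf hj hnew ha⟩
  | migrate j i d hj hd himprove hbest =>
    refine ⟨hQ.migrate hj hd, fun a ha => ⟨(hQ.queued_migrate hj hd).2 ha, ?_⟩⟩
    by_cases h : a = j
    · subst h
      have h1 : a ∈ Function.update (Function.update Q i ((Q i).erase a)) d (Q d ++ [a]) d := by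
        simp
      have h2 : (1 + δ) * jobUtility f I Q a < jobUtility f I
          (Function.update (Function.update Q i ((Q i).erase a)) d (Q d ++ [a])) a := by
        rw [jobUtility_eq hQ hj, jobUtility_eq (hQ.migrate hj hd) h1, Function.update_self,
          aheadWeight_append_self fun h => hd (hQ.inj h hj)]
        exact himprove
      have h3 := jobUtility_nonneg hf hQ ha
      exact ⟨by nlinarith, fun _ => h2⟩
    · rw [hQ.migrate_eq hj hd]
      obtain ⟨h1, h2⟩ := hQ.improvesFor_filter (δ := δ) (p := fun a => decide (a ≠ j)) hf ha
        (by simpa using h)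
      exact h2.trans hδ ((hQ.filter _).improvesFor_arrive hf (hQ.mem_jobs hj) (by simp) h1).2

theorem improves_of_reflTransGen (hf : ∀ i, IsPowerFunction (f i)) (hδ : 0 ≤ δ)
    (hQ : ValidQueues I Q) (h : Relation.ReflTransGen (SelfishStep f I δ t) Q Q') :
    ValidQueues I Q' ∧ ∀ j, Queued Q j → Queued Q' j ∧ ImprovesFor f I δ Q Q' j := by
  induction h with
  | refl => exact ⟨hQ, fun j hj => ⟨hj, .refl _ _⟩⟩
  | tail _ hstep ih =>
    have := hstep.improves hf hδ ih.1
    refine ⟨this.1, fun j hj => ?_⟩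
    have h1 := ih.2 j hj
    have h2 := this.2 j h1.1
    exact ⟨h2.1, h1.2.trans hδ h2.2⟩

/-- The potential is the sum of the utilities of the queued jobs. A migration strictly increases it,
so no migration is possible at a reachable state that maximizes it. -/
theorem exists_reachable_isEquilibrium (hf : ∀ i, IsPowerFunction (f i)) (hδ : 0 ≤ δ)
    (hQ : ValidQueues I Q) (t : ℝ) :
    ∃ Q', Relation.ReflTransGen (SelfishStep f I δ t) Q Q' ∧ ValidQueues I Q' ∧
      (∀ j, Queued Q' j ↔ Queued Q j) ∧ IsEquilibrium f I δ Q' := by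
  classical
  set R : Set (Queues m) := {Q' | Relation.ReflTransGen (SelfishStep f I δ t) Q Q' ∧
    ValidQueues I Q' ∧ ∀ j, Queued Q' j ↔ Queued Q j}
  have hR : R.Finite := (finite_validQueues I).subset fun Q' h => h.2.1
  obtain ⟨P, hP, hmax⟩ := Set.exists_max_image R
    (fun P => ∑ j ∈ I.jobs.filter (Queued Q), jobUtility f I P j) hR
    ⟨Q, .refl, hQ, fun j => Iff.rfl⟩
  refine ⟨P, hP.1, hP.2.1, hP.2.2, fun i j hj d hd => ?_⟩
  by_contra! hlt
  -- A profitable move to `d` need not be a legal one; the best response `d'` is at least as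
  -- profitable and legal.
  obtain ⟨d', hd', hbest⟩ := Finset.exists_max_image (Finset.univ.filter fun d' => d' ≠ i)
    (fun d' => utility f I d' j (listWeight I (P d'))) ⟨d, by simpa using hd⟩
  simp only [Finset.mem_filter, Finset.mem_univ, true_and] at hd' hbest
  have hstep : SelfishStep f I δ t P _ :=
    .migrate P j i d' hj hd' (hlt.trans_le (hbest d hd)) hbest
  have himp := hstep.improves hf hδ hP.2.1
  have hmem : _ ∈ R := ⟨hP.1.tail hstep, himp.1, fun a =>
    (hP.2.1.queued_migrate hj hd').trans (hP.2.2 a)⟩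
  refine absurd (hmax _ hmem) (not_le.2 ?_)
  have hjq : Queued P j := ⟨i, hj⟩
  refine Finset.sum_lt_sum (fun a ha => ?_) ⟨j, ?_, ?_⟩
  · exact (himp.2 a ((hP.2.2 a).2 (Finset.mem_filter.1 ha).2)).2.1
  · exact Finset.mem_filter.2 ⟨hP.2.1.mem_jobs hj, (hP.2.2 j).1 hjq⟩
  · have hne : machineOf P j ≠ machineOf (Function.update (Function.update P i ((P i).erase j)) d'
        (P d' ++ [j])) j := by
      rw [hP.2.1.machineOf_eq hj, himp.1.machineOf_eq (i := d') (by simp)]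
      exact hd'.symm
    refine lt_of_le_of_lt ?_ ((himp.2 j hjq).2.2 hne)
    have := jobUtility_nonneg hf hP.2.1 hjq
    nlinarith

theorem exists_reachable_arrivals (hQ : ValidQueues I Q) (t : ℝ) (L : Finset ℕ)
    (hL : ∀ j ∈ L, j ∈ I.jobs ∧ I.release j = t ∧ ¬ Queued Q j) :
    ∃ Q', Relation.ReflTransGen (SelfishStep f I δ t) Q Q' ∧ ValidQueues I Q' ∧
      ∀ j, Queued Q' j ↔ Queued Q j ∨ j ∈ L := by
  classical
  induction L using Finset.induction_on with
  | empty => exact ⟨Q, .refl, hQ, by simp⟩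
  | insert j L hj ih =>
    obtain ⟨P, h1, h2, h3⟩ := ih fun a ha => hL a (Finset.mem_insert_of_mem ha)
    obtain ⟨hjI, hr, hjQ⟩ := hL j (Finset.mem_insert_self _ _)
    have hnew : ∀ d, j ∉ P d := fun d hd => ((h3 j).1 ⟨d, hd⟩).elim hjQ hj
    obtain ⟨i, hi⟩ := Finite.exists_max fun d => utility f I d j (listWeight I (P d))
    refine ⟨_, h1.tail (.arrive P j i hjI hr hnew hi), h2.arrive hjI hnew, fun a => ?_⟩
    rw [queued_arrive, h3, Finset.mem_insert]
    tauto

end State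

/-! ### Observations and the history of the queues. -/

section

variable {m : ℕ}

open Classical in
/-- The observation at time `t` on instance `I`, when the completion times are `c`. -/
def obsOf (I : JobInstance m) (c : ℕ → ℝ≥0∞) (t : ℝ) : Observation m where
  time := t
  released := I.jobs.filter fun j => I.release j ≤ t
  release j := if j ∈ I.jobs ∧ I.release j ≤ t then I.release j else 0
  weight j := if j ∈ I.jobs ∧ I.release j ≤ t then I.weight j else 0
  rate i j := if j ∈ I.jobs ∧ I.release j ≤ t then I.rate i j else 0
  completion j :=
    if j ∈ I.jobs ∧ I.release j ≤ t ∧ c j ≤ ENNReal.ofReal t then c j else ∞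

theorem observe_eq_obsOf (aug : ℝ) (I : JobInstance m) (S : Schedule m) (t : ℝ) :
    observe aug I S t = obsOf I (completionTime aug I S) t := rfl

/-- Job `j` is active at time `t`, when the completion times are `c`. -/
def ActiveAt (I : JobInstance m) (c : ℕ → ℝ≥0∞) (j : ℕ) (t : ℝ) : Prop :=
  j ∈ I.jobs ∧ I.release j ≤ t ∧ ENNReal.ofReal t < c j

theorem mem_released_obsOf {I : JobInstance m} {c : ℕ → ℝ≥0∞} {t : ℝ} {j : ℕ} :
    j ∈ (obsOf I c t).released ↔ j ∈ I.jobs ∧ I.release j ≤ t := by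
  simp [obsOf]

theorem agreeUntil_of_obsOf_eq {I I' : JobInstance m} {c c' : ℕ → ℝ≥0∞} {t : ℝ}
    (h : obsOf I' c' t = obsOf I c t) : AgreeUntil t I' I := by
  intro j hj hr
  have h1 : j ∈ I.jobs ∧ I.release j ≤ t := by
    rw [← mem_released_obsOf (c := c), ← h, mem_released_obsOf]
    exact ⟨hj, hr⟩
  have h2 := congrFun (congrArg Observation.release h) j
  have h3 := congrFun (congrArg Observation.weight h) j
  have h4 := fun i => congrFun (congrFun (congrArg Observation.rate h) i) j
  simp only [obsOf, h1, hj, hr, true_and, if_true] at h2 h3 h4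
  exact ⟨h1.1, h2.symm, h3, h4⟩

theorem activeAt_iff_obsOf {I : JobInstance m} {c : ℕ → ℝ≥0∞} {t : ℝ} {j : ℕ} :
    ActiveAt I c j t ↔ j ∈ (obsOf I c t).released ∧ (obsOf I c t).completion j = ∞ := by
  rw [mem_released_obsOf, ActiveAt, and_assoc]
  refine and_congr_right fun h1 => and_congr_right fun h2 => ?_
  simp only [obsOf, h1, h2, true_and]
  split_ifs with h
  · simp only [not_lt.2 h, false_iff]
    exact (h.trans_lt ENNReal.ofReal_lt_top).ne
  · simpa using h

open Classical in
/-- At time `t` the queues `Q` may replace the queues `P`. -/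
def NextState (f : Fin m → ℝ → ℝ) (δ : ℝ) (I : JobInstance m) (c : ℕ → ℝ≥0∞) (t : ℝ)
    (P Q : Queues m) : Prop :=
  Relation.ReflTransGen (SelfishStep f I δ t)
      (fun i => (P i).filter fun j => decide (ActiveAt I c j t)) Q ∧
    IsEquilibrium f I δ Q ∧ ∀ j, Queued Q j ↔ ActiveAt I c j t

/-- The queues chosen on the basis of an observation, when `P` are the queues before. -/
def nextQueues (f : Fin m → ℝ → ℝ) (δ : ℝ) (o : Observation m) (P : Queues m) : Queues m :=
  Classical.epsilon fun Q => ∃ I c, obsOf I c o.time = o ∧ NextState f δ I c o.time P Q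

variable {f : Fin m → ℝ → ℝ} {δ : ℝ} {I : JobInstance m} {c : ℕ → ℝ≥0∞} {t : ℝ} {P : Queues m}

/-- Apply `F τ` to the queues for all `τ` in `E` in increasing order, starting from empty queues. -/
def foldEvents (F : ℝ → Queues m → Queues m) (E : Finset ℝ) : Queues m :=
  (E.sort (· ≤ ·)).foldl (fun P τ => F τ P) fun _ => []

theorem foldEvents_insert (F : ℝ → Queues m → Queues m) {E : Finset ℝ} {a : ℝ}
    (h : ∀ x ∈ E, x < a) : foldEvents F (insert a E) = F a (foldEvents F E) := by
  have : (insert a E).sort (· ≤ ·) = E.sort (· ≤ ·) ++ [a] := by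
    refine List.Perm.eq_of_pairwise (le := (· ≤ ·)) (fun _ _ _ _ h h' => le_antisymm h h')
      (Finset.pairwise_sort _ _) ?_ ?_
    · rw [List.pairwise_append]
      refine ⟨Finset.pairwise_sort _ _, by simp, fun x hx y hy => ?_⟩
      rw [List.mem_singleton.1 hy]
      exact (h x ((Finset.mem_sort _).1 hx)).le
    · refine (List.perm_ext_iff_of_nodup (Finset.sort_nodup _ _) ?_).2 fun x => ?_
      · refine (Finset.sort_nodup _ _).append (List.nodup_singleton a) ?_
        simpa using fun ha => lt_irrefl a (h a ha)
      · simp [or_comm]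
  rw [foldEvents, this, List.foldl_append]
  rfl

theorem foldEvents_congr {F F' : ℝ → Queues m → Queues m} {E : Finset ℝ}
    (h : ∀ x ∈ E, F x = F' x) : foldEvents F E = foldEvents F' E := by
  unfold foldEvents
  refine List.foldl_ext _ _ _ fun P x hx => ?_
  rw [h x ((Finset.mem_sort _).1 hx)]

open Classical in
/-- The part of an observation that was available at the earlier time `τ`. -/
def Observation.until (o : Observation m) (τ : ℝ) : Observation m where
  time := τ
  released := o.released.filter fun j => o.release j ≤ τ
  release j := if j ∈ o.released ∧ o.release j ≤ τ then o.release j else 0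
  weight j := if j ∈ o.released ∧ o.release j ≤ τ then o.weight j else 0
  rate i j := if j ∈ o.released ∧ o.release j ≤ τ then o.rate i j else 0
  completion j :=
    if j ∈ o.released ∧ o.release j ≤ τ ∧ o.completion j ≤ ENNReal.ofReal τ then o.completion j
    else ∞

/-- The observation records the release and completion times already past, so every earlier
observation can be recovered. An algorithm without memory can therefore replay its queue history. -/
theorem obsOf_until {τ : ℝ} (h : τ ≤ t) : (obsOf I c t).until τ = obsOf I c τ := by
  have key : ∀ j, (j ∈ (obsOf I c t).released ∧ (obsOf I c t).release j ≤ τ) ↔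
      (j ∈ I.jobs ∧ I.release j ≤ τ) := by
    intro j
    rw [mem_released_obsOf]
    constructor
    · rintro ⟨⟨h1, h2⟩, h3⟩
      simp only [obsOf, h1, h2, true_and, if_true] at h3
      exact ⟨h1, h3⟩
    · rintro ⟨h1, h2⟩
      refine ⟨⟨h1, h2.trans h⟩, ?_⟩
      simpa only [obsOf, h1, h2.trans h, true_and, if_true] using h2
  have hτ := ENNReal.ofReal_le_ofReal h
  rw [Observation.until]
  conv_rhs => rw [obsOf]
  congr 1
  · ext j
    rw [Finset.mem_filter, Finset.mem_filter]
    exact key j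
  · funext j
    by_cases hj : j ∈ I.jobs ∧ I.release j ≤ τ
    · rw [if_pos ((key j).2 hj), if_pos hj]
      simp [obsOf, hj.1, hj.2.trans h]
    · rw [if_neg fun h => hj ((key j).1 h), if_neg hj]
  · funext j
    by_cases hj : j ∈ I.jobs ∧ I.release j ≤ τ
    · rw [if_pos ((key j).2 hj), if_pos hj]
      simp [obsOf, hj.1, hj.2.trans h]
    · rw [if_neg fun h => hj ((key j).1 h), if_neg hj]
  · funext i j
    by_cases hj : j ∈ I.jobs ∧ I.release j ≤ τ
    · rw [if_pos ((key j).2 hj), if_pos hj]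
      simp [obsOf, hj.1, hj.2.trans h]
    · rw [if_neg fun h => hj ((key j).1 h), if_neg hj]
  · funext j
    by_cases hj : j ∈ I.jobs ∧ I.release j ≤ τ
    · have h1 := (key j).2 hj
      simp only [h1.1, h1.2, hj.1, hj.2, true_and]
      by_cases hc : c j ≤ ENNReal.ofReal τ
      · have : (obsOf I c t).completion j = c j := by
          simp [obsOf, hj.1, hj.2.trans h, hc.trans hτ]
        rw [this]
      · rw [if_neg hc, if_neg]
        simp only [obsOf, hj.1, hj.2.trans h, true_and]
        split_ifs <;> simp [hc]
    · rw [if_neg fun h => hj ((key j).1 ⟨h.1, h.2.1⟩), if_neg fun h => hj ⟨h.1, h.2.1⟩]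

open Classical in
/-- The events that have been observed: releases and completions. -/
def Observation.events (o : Observation m) : Finset ℝ :=
  o.released.image o.release ∪ (o.released.filter fun j => o.completion j ≠ ∞).image
    fun j => max (o.release j) (o.completion j).toReal

open Classical in
/-- All events: releases and completions. -/
def allEvents (I : JobInstance m) (c : ℕ → ℝ≥0∞) : Finset ℝ :=
  I.jobs.image I.release ∪ (I.jobs.filter fun j => c j ≠ ∞).image
    fun j => max (I.release j) (c j).toReal

theorem release_mem_allEvents {j : ℕ} (hj : j ∈ I.jobs) : I.release j ∈ allEvents I c :=
  Finset.mem_union_left _ (Finset.mem_image_of_mem _ hj)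

/-- For arbitrary `c` a completion time may precede the release; the maximum is the first instant at
which it becomes visible. -/
theorem completion_mem_allEvents {j : ℕ} (hj : j ∈ I.jobs) (hc : c j ≠ ∞) :
    max (I.release j) (c j).toReal ∈ allEvents I c := by
  classical
  exact Finset.mem_union_right _ (Finset.mem_image_of_mem (fun j => max (I.release j) (c j).toReal)
    (Finset.mem_filter.2 ⟨hj, hc⟩))

theorem events_obsOf : (obsOf I c t).events = (allEvents I c).filter (· ≤ t) := by
  classical
  ext x
  simp only [Observation.events, allEvents, Finset.mem_union, Finset.mem_image, Finset.mem_filter,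
    mem_released_obsOf]
  have hrel : ∀ {j}, j ∈ I.jobs → I.release j ≤ t → (obsOf I c t).release j = I.release j := by
    intro j h1 h2; simp [obsOf, h1, h2]
  have hcomp : ∀ {j}, j ∈ I.jobs → I.release j ≤ t → c j ≤ ENNReal.ofReal t →
      (obsOf I c t).completion j = c j := by
    intro j h1 h2 h3; simp [obsOf, h1, h2, h3]
  constructor
  · rintro (⟨j, ⟨h1, h2⟩, rfl⟩ | ⟨j, ⟨⟨h1, h2⟩, h3⟩, rfl⟩)
    · rw [hrel h1 h2]
      exact ⟨Or.inl ⟨j, h1, rfl⟩, h2⟩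
    · have h4 : c j ≤ ENNReal.ofReal t := by
        by_contra h4
        exact h3 (by simp [obsOf, h4])
      rw [hcomp h1 h2 h4] at h3
      rw [hcomp h1 h2 h4, hrel h1 h2]
      refine ⟨Or.inr ⟨j, ⟨h1, h3⟩, rfl⟩, max_le h2 ?_⟩
      exact (ENNReal.le_ofReal_iff_toReal_le h3 ((I.release_nonneg j h1).trans h2)).1 h4
  · rintro ⟨⟨j, h1, rfl⟩ | ⟨j, ⟨h1, h3⟩, rfl⟩, hx⟩
    · exact Or.inl ⟨j, ⟨h1, hx⟩, hrel h1 hx⟩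
    · have h2 := (le_max_left _ _).trans hx
      have h4 := (ENNReal.le_ofReal_iff_toReal_le h3 ((I.release_nonneg j h1).trans h2)).2
        ((le_max_right _ _).trans hx)
      exact Or.inr ⟨j, ⟨⟨h1, h2⟩, by rwa [hcomp h1 h2 h4]⟩, by rw [hcomp h1 h2 h4, hrel h1 h2]⟩

/-- The queues that the algorithm maintains, as a function of the observation. -/
def queuesOf (f : Fin m → ℝ → ℝ) (δ : ℝ) (o : Observation m) : Queues m :=
  foldEvents (fun τ => nextQueues f δ (o.until τ)) o.events

/-- The queues of the algorithm at time `t`. -/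
def queueAt (f : Fin m → ℝ → ℝ) (δ : ℝ) (I : JobInstance m) (c : ℕ → ℝ≥0∞) (t : ℝ) : Queues m :=
  foldEvents (fun τ => nextQueues f δ (obsOf I c τ)) ((allEvents I c).filter (· ≤ t))

theorem queuesOf_obsOf : queuesOf f δ (obsOf I c t) = queueAt f δ I c t := by
  rw [queuesOf, queueAt, events_obsOf]
  refine foldEvents_congr fun x hx => ?_
  rw [obsOf_until (Finset.mem_filter.1 hx).2]

theorem queueAt_eq_of_no_event {s t : ℝ} (hst : s ≤ t)
    (h : ∀ x ∈ allEvents I c, x ≤ t → x ≤ s) : queueAt f δ I c t = queueAt f δ I c s := by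
  rw [queueAt, queueAt]
  congr 1
  exact Finset.filter_congr fun x hx => ⟨h x hx, fun h' => h'.trans hst⟩

theorem queueAt_event {s e : ℝ} (he : e ∈ allEvents I c) (hs : s < e)
    (h : ∀ x ∈ allEvents I c, x < e → x ≤ s) :
    queueAt f δ I c e = nextQueues f δ (obsOf I c e) (queueAt f δ I c s) := by
  classical
  have : (allEvents I c).filter (· ≤ e) = insert e ((allEvents I c).filter (· ≤ s)) := by
    ext x
    simp only [Finset.mem_filter, Finset.mem_insert]
    constructor
    · rintro ⟨h1, h2⟩
      rcases h2.lt_or_eq with h3 | h3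
      · exact Or.inr ⟨h1, h x h1 h3⟩
      · exact Or.inl h3
    · rintro (rfl | ⟨h1, h2⟩)
      · exact ⟨he, le_rfl⟩
      · exact ⟨h1, h2.trans hs.le⟩
  rw [queueAt, this, foldEvents_insert]
  · rfl
  · exact fun x hx => (Finset.mem_filter.1 hx).2.trans_lt hs

/-- Supplies a time at which the queues are those immediately before the event `e`, without going
back beyond `s`. -/
theorem exists_le_lt_no_event (E : Finset ℝ) {s e : ℝ} (hs : s < e) :
    ∃ s', s ≤ s' ∧ s' < e ∧ ∀ x ∈ E, x < e → x ≤ s' := by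
  classical
  have hne : (insert s (E.filter (· < e))).Nonempty := ⟨s, Finset.mem_insert_self _ _⟩
  refine ⟨(insert s (E.filter (· < e))).max' hne,
    Finset.le_max' _ _ (Finset.mem_insert_self _ _), ?_, fun x hx hxe =>
    Finset.le_max' _ _ (Finset.mem_insert_of_mem (Finset.mem_filter.2 ⟨hx, hxe⟩))⟩
  rw [Finset.max'_lt_iff]
  intro x hx
  rcases Finset.mem_insert.1 hx with rfl | hx
  · exact hs
  · exact (Finset.mem_filter.1 hx).2

theorem activeAt_iff_of_no_event {s t : ℝ} (hst : s ≤ t)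
    (h : ∀ x ∈ allEvents I c, x ≤ t → x ≤ s) (j : ℕ) :
    ActiveAt I c j t ↔ ActiveAt I c j s := by
  constructor
  · rintro ⟨h1, h2, h3⟩
    exact ⟨h1, h _ (release_mem_allEvents h1) h2, (ENNReal.ofReal_le_ofReal hst).trans_lt h3⟩
  · rintro ⟨h1, h2, h3⟩
    refine ⟨h1, h2.trans hst, ?_⟩
    by_contra! h4
    have hc : c j ≠ ∞ := (h4.trans_lt ENNReal.ofReal_lt_top).ne
    have hs : 0 ≤ s := (I.release_nonneg j h1).trans h2
    have h5 := h _ (completion_mem_allEvents h1 hc) (max_le (h2.trans hst)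
      ((ENNReal.le_ofReal_iff_toReal_le hc (hs.trans hst)).1 h4))
    exact absurd ((ENNReal.le_ofReal_iff_toReal_le hc hs).2 ((le_max_right _ _).trans h5))
      (not_le.2 h3)

theorem activeAt_of_le {s t : ℝ} {j : ℕ} (hst : s ≤ t) (h : ActiveAt I c j t)
    (hs : I.release j ≤ s) : ActiveAt I c j s :=
  ⟨h.1, hs, (ENNReal.ofReal_le_ofReal hst).trans_lt h.2.2⟩

/-- The invariants of the queues. -/
structure QueueInvariant (f : Fin m → ℝ → ℝ) (δ : ℝ) (I : JobInstance m) (c : ℕ → ℝ≥0∞) (t : ℝ)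
    (Q : Queues m) : Prop where
  valid : ValidQueues I Q
  queued_iff : ∀ j, Queued Q j ↔ ActiveAt I c j t
  equilibrium : IsEquilibrium f I δ Q

/-- The set of past events determines the queues, so the queues take finitely many values. -/
theorem exists_queueAt_eq (f : Fin m → ℝ → ℝ) (δ : ℝ) (I : JobInstance m) (c : ℕ → ℝ≥0∞) :
    ∃ G : (allEvents I c → Bool) → Queues m,
      ∀ t, queueAt f δ I c t = G fun e => decide ((e : ℝ) ≤ t) := by
  classical
  refine ⟨fun b => foldEvents (fun τ => nextQueues f δ (obsOf I c τ))
    ((allEvents I c).attach.filter (fun e => b e = true) |>.image Subtype.val), fun t => ?_⟩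
  rw [queueAt]
  congr 1
  ext x
  simp only [Finset.mem_filter, Finset.mem_image, Finset.mem_attach, true_and, decide_eq_true_eq,
    Subtype.exists, exists_and_left, exists_prop, exists_eq_right_right]
  tauto

theorem measurable_comp_queueAt {α : Type*} [MeasurableSpace α] (f : Fin m → ℝ → ℝ) (δ : ℝ)
    (I : JobInstance m) (c : ℕ → ℝ≥0∞) (φ : Queues m → α) :
    Measurable fun t => φ (queueAt f δ I c t) := by
  obtain ⟨G, hG⟩ := exists_queueAt_eq f δ I c
  simp only [hG]
  have h1 : Measurable fun t : ℝ => fun e : allEvents I c => decide ((e : ℝ) ≤ t) := by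
    refine measurable_pi_lambda _ fun e => ?_
    refine measurable_to_bool ?_
    have : (fun t : ℝ => decide ((e : ℝ) ≤ t)) ⁻¹' {true} = Set.Ici (e : ℝ) := by
      ext; simp
    rw [this]
    exact measurableSet_Ici
  exact (Measurable.of_discrete (f := fun b => φ (G b))).comp h1

theorem exists_forall_queueAt_le (f : Fin m → ℝ → ℝ) (δ : ℝ) (I : JobInstance m) (c : ℕ → ℝ≥0∞)
    (φ : Queues m → ℝ) : ∃ B, ∀ t, φ (queueAt f δ I c t) ≤ B := by
  obtain ⟨G, hG⟩ := exists_queueAt_eq f δ I c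
  obtain ⟨B, hB⟩ := (Set.finite_range fun b => φ (G b)).bddAbove
  exact ⟨B, fun t => by rw [hG]; exact hB ⟨_, rfl⟩⟩

variable [Nonempty (Fin m)]

theorem exists_nextState (hf : ∀ i, IsPowerFunction (f i)) (hδ : 0 ≤ δ) (hP : ValidQueues I P)
    (hr : ∀ j, Queued P j → I.release j < t)
    (ha : ∀ j, ActiveAt I c j t → I.release j < t → Queued P j) :
    ∃ Q, NextState f δ I c t P Q := by
  classical
  have hq : ∀ j, Queued (fun i => (P i).filter fun j => decide (ActiveAt I c j t)) j ↔
      Queued P j ∧ ActiveAt I c j t := by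
    intro j; simp [Queued]
  obtain ⟨Q₁, h1, h2, h3⟩ := exists_reachable_arrivals (f := f) (δ := δ)
    (hP.filter fun j => decide (ActiveAt I c j t)) t
    (I.jobs.filter fun j => ActiveAt I c j t ∧ I.release j = t) (by
      intro j hj
      simp only [Finset.mem_filter] at hj
      exact ⟨hj.1, hj.2.2, fun h => (hr j ((hq j).1 h).1).ne hj.2.2⟩)
  obtain ⟨Q₂, h4, h5, h6, h7⟩ := exists_reachable_isEquilibrium hf hδ h2 t
  refine ⟨Q₂, h1.trans h4, h7, fun j => ?_⟩
  rw [h6, h3, hq, Finset.mem_filter]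
  constructor
  · rintro (h | h)
    exacts [h.2, h.2.1]
  · intro h
    rcases h.2.1.lt_or_eq with h' | h'
    · exact Or.inl ⟨ha j h h', h⟩
    · exact Or.inr ⟨h.1, h, h'⟩

/-- The choice may be justified by a different instance and different completion times with the same
observation. Activity and all data read by the steps are determined by that observation, so the same
choice is correct for the actual instance. -/
theorem nextQueues_spec (hf : ∀ i, IsPowerFunction (f i)) (hδ : 0 ≤ δ) (hP : ValidQueues I P)
    (hr : ∀ j, Queued P j → I.release j < t)
    (ha : ∀ j, ActiveAt I c j t → I.release j < t → Queued P j) :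
    NextState f δ I c t P (nextQueues f δ (obsOf I c t) P) := by
  classical
  obtain ⟨Q₀, hQ₀⟩ := exists_nextState hf hδ hP hr ha
  obtain ⟨I', c', h1, h2, h3, h4⟩ := Classical.epsilon_spec
    (p := fun Q => ∃ I' c', obsOf I' c' (obsOf I c t).time = obsOf I c t ∧
      NextState f δ I' c' (obsOf I c t).time P Q) ⟨Q₀, I, c, rfl, hQ₀⟩
  change obsOf I' c' t = obsOf I c t at h1
  change ∀ j, Queued (nextQueues f δ (obsOf I c t) P) j ↔ ActiveAt I' c' j t at h4
  change Relation.ReflTransGen (SelfishStep f I' δ t) _ (nextQueues f δ (obsOf I c t) P) at h2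
  have hact : ∀ j, ActiveAt I' c' j t ↔ ActiveAt I c j t := fun j => by
    rw [activeAt_iff_obsOf, activeAt_iff_obsOf, h1]
  have hI := agreeUntil_of_obsOf_eq h1
  have hstart : (fun i => (P i).filter fun j => decide (ActiveAt I' c' j (obsOf I c t).time)) =
      (fun i => (P i).filter fun j => decide (ActiveAt I c j t)) := by
    funext i
    congr 1
    funext j
    exact decide_eq_decide.2 (hact j)
  have hrel := hI.reflTransGen (fun j hj => by
    obtain ⟨i, hi⟩ := hj
    have := of_decide_eq_true (List.mem_filter.1 hi).2
    exact ⟨this.1, this.2.1⟩) h2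
  refine ⟨hstart ▸ hrel.1, hI.isEquilibrium hrel.2 h3, fun j => (h4 j).trans (hact j)⟩

theorem QueueInvariant.nextState {s e : ℝ} (hf : ∀ i, IsPowerFunction (f i)) (hδ : 0 ≤ δ)
    (hs : s < e) (h : ∀ x ∈ allEvents I c, x < e → x ≤ s) (hP : QueueInvariant f δ I c s P) :
    NextState f δ I c e P (nextQueues f δ (obsOf I c e) P) := by
  refine nextQueues_spec hf hδ hP.valid (fun j hj => ?_) fun j hj hr => ?_
  · exact ((hP.queued_iff j).1 hj).2.1.trans_lt hs
  · exact (hP.queued_iff j).2 (activeAt_of_le hs.le hj (h _ (release_mem_allEvents hj.1) hr))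

/-- Strong induction on the number of past events: nothing changes after the last event `e`, and
fewer events precede a time just before `e`. -/
theorem queueInvariant_queueAt (hf : ∀ i, IsPowerFunction (f i)) (hδ : 0 ≤ δ) (I : JobInstance m)
    (c : ℕ → ℝ≥0∞) (t : ℝ) : QueueInvariant f δ I c t (queueAt f δ I c t) := by
  classical
  induction hn : ((allEvents I c).filter (· ≤ t)).card using Nat.strong_induction_on
    generalizing t with
  | _ n ih =>
    rcases ((allEvents I c).filter (· ≤ t)).eq_empty_or_nonempty with h0 | h0
    · have h1 : queueAt f δ I c t = fun _ => [] := by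
        rw [queueAt, h0]; simp [foldEvents]
      rw [h1]
      refine ⟨⟨by simp, by simp, by simp⟩, fun j => ?_, by simp [IsEquilibrium]⟩
      simp only [Queued, List.not_mem_nil, exists_false, false_iff]
      intro h
      have : I.release j ∈ (allEvents I c).filter (· ≤ t) :=
        Finset.mem_filter.2 ⟨release_mem_allEvents h.1, h.2.1⟩
      simp [h0] at this
    · set e := ((allEvents I c).filter (· ≤ t)).max' h0
      have hemem : e ∈ (allEvents I c).filter (· ≤ t) := Finset.max'_mem _ _
      have he := (Finset.mem_filter.1 hemem).1
      have het := (Finset.mem_filter.1 hemem).2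
      have hmax : ∀ x ∈ allEvents I c, x ≤ t → x ≤ e := fun x hx hxt =>
        Finset.le_max' _ _ (Finset.mem_filter.2 ⟨hx, hxt⟩)
      suffices H : QueueInvariant f δ I c e (queueAt f δ I c e) by
        rw [queueAt_eq_of_no_event het hmax]
        exact ⟨H.valid, fun j => by rw [H.queued_iff, activeAt_iff_of_no_event het hmax],
          H.equilibrium⟩
      obtain ⟨s, -, hs, hse⟩ := exists_le_lt_no_event (allEvents I c) (sub_one_lt e)
      have hP := ih _ (by
        rw [← hn]
        refine Finset.card_lt_card (Finset.ssubset_iff_subset_ne.2 ⟨fun x hx => ?_, fun heq => ?_⟩)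
        · rw [Finset.mem_filter] at hx ⊢
          exact ⟨hx.1, hx.2.trans (hs.le.trans het)⟩
        · rw [← heq, Finset.mem_filter] at hemem
          exact absurd hemem.2 (not_le.2 hs)) s rfl
      obtain ⟨h1, h2, h3⟩ := hP.nextState hf hδ hs hse
      rw [queueAt_event he hs hse]
      exact ⟨(improves_of_reflTransGen hf hδ (hP.valid.filter _) h1).1, h3, h2⟩

/-- The utility of an active job never decreases, and grows by a factor `1 + δ` whenever its
machine changes. -/
theorem improvesFor_queueAt (hf : ∀ i, IsPowerFunction (f i)) (hδ : 0 ≤ δ) {s t : ℝ} (hst : s ≤ t)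
    {j : ℕ} (hs : I.release j ≤ s) (ht : ActiveAt I c j t) :
    ImprovesFor f I δ (queueAt f δ I c s) (queueAt f δ I c t) j := by
  classical
  induction hn : ((allEvents I c).filter (· ≤ t)).card using Nat.strong_induction_on
    generalizing t with
  | _ n ih =>
    by_cases h : ∀ x ∈ allEvents I c, x ≤ t → x ≤ s
    · rw [queueAt_eq_of_no_event hst h]; exact .refl _ _
    push Not at h
    obtain ⟨x, hx, hxt, hsx⟩ := h
    have h0 : ((allEvents I c).filter (· ≤ t)).Nonempty := ⟨x, Finset.mem_filter.2 ⟨hx, hxt⟩⟩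
    set e := ((allEvents I c).filter (· ≤ t)).max' h0
    have hemem : e ∈ (allEvents I c).filter (· ≤ t) := Finset.max'_mem _ _
    have he := (Finset.mem_filter.1 hemem).1
    have het := (Finset.mem_filter.1 hemem).2
    have hmax : ∀ x ∈ allEvents I c, x ≤ t → x ≤ e := fun x hx hxt =>
      Finset.le_max' _ _ (Finset.mem_filter.2 ⟨hx, hxt⟩)
    have hse : s < e := hsx.trans_le (hmax x hx hxt)
    obtain ⟨s', hss', hs', hno⟩ := exists_le_lt_no_event (allEvents I c) hse
    have hact' : ActiveAt I c j s' := activeAt_of_le (hs'.le.trans het) ht (hs.trans hss')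
    have hacte : ActiveAt I c j e := activeAt_of_le het ht (hs.trans hse.le)
    refine (ih _ ?_ hss' hact' rfl).trans hδ ?_
    · rw [← hn]
      refine Finset.card_lt_card (Finset.ssubset_iff_subset_ne.2 ⟨fun x hx => ?_, fun heq => ?_⟩)
      · rw [Finset.mem_filter] at hx ⊢
        exact ⟨hx.1, hx.2.trans (hs'.le.trans het)⟩
      · rw [← heq, Finset.mem_filter] at hemem
        exact absurd hemem.2 (not_le.2 hs')
    · have hP := queueInvariant_queueAt hf hδ I c s'
      obtain ⟨h1, h2, h3⟩ := hP.nextState hf hδ hs' hno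
      rw [queueAt_eq_of_no_event het hmax, queueAt_event he hs' hno]
      obtain ⟨h4, h5⟩ := hP.valid.improvesFor_filter (δ := δ) (j := j)
        (p := fun j => decide (ActiveAt I c j e)) hf ((hP.queued_iff j).2 hact')
        (decide_eq_true hacte)
      exact h5.trans hδ ((improves_of_reflTransGen hf hδ (hP.valid.filter _) h1).2 j h4).2

/-- The queues change only at isolated times, according to the sequential dynamics. -/
theorem queueAt_dynamics (hf : ∀ i, IsPowerFunction (f i)) (hδ : 0 ≤ δ) (I : JobInstance m)
    (c : ℕ → ℝ≥0∞) (t : ℝ) : ∃ P : Queues m, ∃ η > 0,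
      (∀ s, t - η < s → s < t → queueAt f δ I c s = P) ∧
      (∀ s, t ≤ s → s < t + η → queueAt f δ I c s = queueAt f δ I c t) ∧
      (∀ p : ℕ → Bool, (∀ j, p j = true ↔ ActiveAt I c j t) →
        Relation.ReflTransGen (SelfishStep f I δ t) (fun i => (P i).filter p)
          (queueAt f δ I c t)) := by
  classical
  -- There are finitely many events, so some neighbourhood of `t` contains no event other than
  -- possibly `t`.
  have hopen : IsOpen (((allEvents I c).erase t : Finset ℝ) : Set ℝ)ᶜ :=
    (Finset.finite_toSet _).isClosed.isOpen_compl
  obtain ⟨η, hη, hball⟩ := Metric.isOpen_iff.1 hopen t (by simp)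
  have hno : ∀ x ∈ allEvents I c, x ≠ t → t - η < x → x < t + η → False := by
    intro x hx hne h1 h2
    have : x ∈ Metric.ball t η := by
      rw [Metric.mem_ball, Real.dist_eq, abs_lt]; constructor <;> linarith
    exact hball this (by simp [hx, hne])
  set s₀ := t - η / 2
  have hs₀ : s₀ < t := by simp only [s₀]; linarith
  have hs₀' : t - η < s₀ := by simp only [s₀]; linarith
  have hbefore : ∀ x ∈ allEvents I c, x < t → x ≤ s₀ := fun x hx hxt => by
    by_contra! h
    exact hno x hx hxt.ne (by linarith) (by linarith)
  refine ⟨queueAt f δ I c s₀, η, hη, fun s h1 h2 => ?_, fun s h1 h2 => ?_, fun p hp => ?_⟩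
  · rcases le_total s s₀ with h | h
    · refine (queueAt_eq_of_no_event h fun x hx hxs => ?_).symm
      by_contra! h3
      exact hno x hx (by linarith) (by linarith) (by linarith)
    · refine queueAt_eq_of_no_event h fun x hx hxs => hbefore x hx (by linarith)
  · refine queueAt_eq_of_no_event h1 fun x hx hxs => ?_
    by_contra! h3
    exact hno x hx h3.ne' (by linarith) (by linarith)
  · have hP := queueInvariant_queueAt hf hδ I c s₀
    by_cases ht : t ∈ allEvents I c
    · have := (hP.nextState hf hδ hs₀ hbefore).1
      rw [← queueAt_event ht hs₀ hbefore] at this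
      convert this using 4 with i j
      exact (Bool.eq_iff_iff).2 (by simp [hp])
    · have hno' : ∀ x ∈ allEvents I c, x ≤ t → x ≤ s₀ := fun x hx hxt =>
        hbefore x hx (lt_of_le_of_ne hxt fun h => ht (h ▸ hx))
      -- Without an event at `t` the filter removes nothing, and the empty sequence of steps
      -- suffices.
      have : (fun i => (queueAt f δ I c s₀ i).filter p) = queueAt f δ I c t := by
        rw [queueAt_eq_of_no_event hs₀.le hno']
        funext i
        rw [List.filter_eq_self]
        intro j hj
        rw [hp, activeAt_iff_of_no_event hs₀.le hno', ← hP.queued_iff]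
        exact ⟨i, hj⟩
      rw [this]

/-- The decision that belongs to given queues and weights: speed scaling and weighted ranked
processor sharing. -/
def decisionOf (f : Fin m → ℝ → ℝ) (k : ℕ) (w : ℕ → ℝ) (Q : Queues m) : Decision m where
  machine := machineOf Q
  share := fun j => open Classical in
    let i := machineOf Q j
    let a := (((Q i).takeWhile fun j' => j' ≠ j).map w).sum
    if Queued Q j then powerInv (f i) ((Q i).map w).sum *
      (((a + w j) ^ (k + 1) - a ^ (k + 1)) / ((Q i).map w).sum ^ (k + 1)) else 0
  speed := fun i => powerInv (f i) ((Q i).map w).sum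

theorem decisionOf_congr {k : ℕ} {w w' : ℕ → ℝ} {Q : Queues m}
    (h : ∀ j, Queued Q j → w j = w' j) : decisionOf f k w Q = decisionOf f k w' Q := by
  have h1 : ∀ i, (Q i).map w = (Q i).map w' := fun i =>
    List.map_congr_left fun j hj => h j ⟨i, hj⟩
  have h2 : ∀ i j, ((Q i).takeWhile fun j' => j' ≠ j).map w =
      ((Q i).takeWhile fun j' => j' ≠ j).map w' := fun i j =>
    List.map_congr_left fun a ha => h a ⟨i, (List.takeWhile_sublist _).subset ha⟩
  unfold decisionOf
  congr 1
  · funext j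
    by_cases hj : Queued Q j
    · simp only [hj, if_true, h1, h2, h j hj]
    · simp only [hj, if_false]
  · simp only [h1]

/-- The algorithm SelfishMigrate-Energy. -/
def selfishMigrateEnergy (f : Fin m → ℝ → ℝ) (k : ℕ) (δ : ℝ) : OnlineAlgorithm m := fun o =>
  decisionOf f k o.weight (queuesOf f δ o)

theorem selfishMigrateEnergy_obsOf (hf : ∀ i, IsPowerFunction (f i)) (k : ℕ) (hδ : 0 ≤ δ)
    (I : JobInstance m) (c : ℕ → ℝ≥0∞) (t : ℝ) :
    selfishMigrateEnergy f k δ (obsOf I c t) = decisionOf f k I.weight (queueAt f δ I c t) := by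
  rw [selfishMigrateEnergy, queuesOf_obsOf]
  refine decisionOf_congr fun j hj => ?_
  have := ((queueInvariant_queueAt hf hδ I c t).queued_iff j).1 hj
  simp [obsOf, this.1, this.2.1]

end

/-! ### Completion times and existence of runs. -/

section Completion

variable {m : ℕ} {aug : ℝ} {I : JobInstance m} {S S' : Schedule m}

theorem processed_mono (j : ℕ) {t t' : ℝ} (h : t ≤ t') :
    processed aug I S j t ≤ processed aug I S j t' :=
  MeasureTheory.lintegral_mono_set (Set.Ioc_subset_Ioc_right h)

theorem completionTime_le {j : ℕ} {t : ℝ} (hr : I.release j ≤ t)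
    (h : ENNReal.ofReal (I.size j) ≤ processed aug I S j t) :
    completionTime aug I S j ≤ ENNReal.ofReal t :=
  sInf_le ⟨t, ⟨hr, h⟩, rfl⟩

theorem processed_lt_of_lt_completionTime {j : ℕ} {t : ℝ} (hr : I.release j ≤ t)
    (h : ENNReal.ofReal t < completionTime aug I S j) :
    processed aug I S j t < ENNReal.ofReal (I.size j) := by
  by_contra! h'
  exact absurd (completionTime_le hr h') (not_le.2 h)

theorem release_le_completionTime (j : ℕ) :
    ENNReal.ofReal (I.release j) ≤ completionTime aug I S j := by
  refine le_sInf ?_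
  rintro _ ⟨t, ⟨h, -⟩, rfl⟩
  exact ENNReal.ofReal_le_ofReal h

/-- A number of units of time slightly larger than the completion time suffices. -/
theorem exists_lt_of_completionTime_lt {j : ℕ} {x : ℝ≥0∞} (h : completionTime aug I S j < x) :
    ∃ t, I.release j ≤ t ∧ ENNReal.ofReal (I.size j) ≤ processed aug I S j t ∧
      ENNReal.ofReal t < x := by
  obtain ⟨_, ⟨t, ⟨h1, h2⟩, rfl⟩, h3⟩ := sInf_lt_iff.1 h
  exact ⟨t, h1, h2, h3⟩

/-- If the processing rate of a job is bounded, its completion time is attained. -/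
theorem exists_completionTime_eq {j : ℕ} (hj : j ∈ I.jobs) {B : ℝ}
    (hB : ∀ t, aug * I.rate ((S t).machine j) j * (S t).share j ≤ B)
    (h : completionTime aug I S j ≠ ∞) :
    ∃ t, I.release j ≤ t ∧ ENNReal.ofReal (I.size j) ≤ processed aug I S j t ∧
      completionTime aug I S j = ENNReal.ofReal t := by
  have hr0 := I.release_nonneg j hj
  set T := (completionTime aug I S j).toReal
  have hT : completionTime aug I S j = ENNReal.ofReal T := (ENNReal.ofReal_toReal h).symm
  have hrT : I.release j ≤ T := by
    have := release_le_completionTime (aug := aug) (I := I) (S := S) j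
    exact (ENNReal.ofReal_le_iff_le_toReal h).1 this
  refine ⟨T, hrT, ?_, hT⟩
  have key : ∀ η : ℝ, 0 < η → ENNReal.ofReal (I.size j) ≤
      processed aug I S j T + ENNReal.ofReal B * ENNReal.ofReal η := by
    intro η hη
    obtain ⟨t, h1, h2, h3⟩ := exists_lt_of_completionTime_lt (x := ENNReal.ofReal (T + η))
      (by rw [hT]; exact (ENNReal.ofReal_lt_ofReal_iff (by linarith)).2 (by linarith))
    rw [ENNReal.ofReal_lt_ofReal_iff (by linarith)] at h3
    refine (h2.trans (processed_mono j h3.le)).trans ?_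
    unfold processed
    rw [← Set.Ioc_union_Ioc_eq_Ioc hrT (show T ≤ T + η by linarith)]
    refine (MeasureTheory.lintegral_union_le _ _ _).trans (add_le_add le_rfl ?_)
    calc _ ≤ ∫⁻ _ in Set.Ioc T (T + η), ENNReal.ofReal B :=
          MeasureTheory.lintegral_mono fun s => ENNReal.ofReal_le_ofReal (hB s)
      _ = _ := by simp
  by_contra! hlt
  obtain ⟨x, hx1, hx2⟩ := ENNReal.lt_iff_exists_add_pos_lt.1 hlt
  have hB1 : 0 < max B 1 := lt_max_of_lt_right one_pos
  -- The slack `x` buys this much extra time; `max B 1` avoids dividing by a bound that is not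
  -- positive.
  have := key (x / max B 1) (div_pos (by exact_mod_cast hx1) hB1)
  refine absurd (this.trans ?_) (not_le.2 hx2)
  gcongr
  calc ENNReal.ofReal B * ENNReal.ofReal (x / max B 1)
      ≤ ENNReal.ofReal (max B 1) * ENNReal.ofReal (x / max B 1) := by
        gcongr; exact le_max_left _ _
    _ = x := by
        rw [← ENNReal.ofReal_mul hB1.le, mul_div_cancel₀ _ hB1.ne']
        simp

/-- Schedules that agree before time `T` have the same completion times up to `T`. -/
theorem completionTime_le_of_eq_before {j : ℕ} (hj : j ∈ I.jobs) {B : ℝ}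
    (hB : ∀ t, aug * I.rate ((S t).machine j) j * (S t).share j ≤ B) {T : ℝ} (hT : 0 ≤ T)
    (hS : ∀ t < T, S t = S' t) (h : completionTime aug I S j ≤ ENNReal.ofReal T) :
    completionTime aug I S' j ≤ completionTime aug I S j := by
  obtain ⟨t, h1, h2, h3⟩ := exists_completionTime_eq hj hB (h.trans_lt ENNReal.ofReal_lt_top).ne
  rw [h3]
  refine completionTime_le h1 (h2.trans_eq ?_)
  have htT : t ≤ T := by
    rw [h3] at h
    exact (ENNReal.ofReal_le_ofReal_iff hT).1 h
  unfold processed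
  -- Agreement holds only strictly before `T`; the endpoint is a null set.
  rw [← MeasureTheory.Measure.restrict_congr_set MeasureTheory.Ioo_ae_eq_Ioc]
  refine MeasureTheory.setLIntegral_congr_fun measurableSet_Ioo fun s hs => ?_
  simp only [hS s (hs.2.trans_le htT)]

theorem obsOf_congr {c c' : ℕ → ℝ≥0∞} {t : ℝ}
    (h : ∀ j ∈ I.jobs, I.release j ≤ t → c j ≤ ENNReal.ofReal t ∨ c' j ≤ ENNReal.ofReal t → c j = c' j) :
    obsOf I c t = obsOf I c' t := by
  unfold obsOf
  congr 1
  funext j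
  by_cases hj : j ∈ I.jobs ∧ I.release j ≤ t
  · by_cases h' : c j ≤ ENNReal.ofReal t ∨ c' j ≤ ENNReal.ofReal t
    · rw [h j hj.1 hj.2 h']
    · rw [not_or] at h'
      simp [h'.1, h'.2]
  · rw [if_neg fun h => hj ⟨h.1, h.2.1⟩, if_neg fun h => hj ⟨h.1, h.2.1⟩]

/-- An online algorithm with bounded processing rates can be run on every instance. -/
theorem exists_isRun (A : OnlineAlgorithm m)
    (hA : ∀ (c : ℕ → ℝ≥0∞), ∀ j ∈ I.jobs, ∃ B, ∀ t, aug * I.rate ((A (obsOf I c t)).machine j) j *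
      (A (obsOf I c t)).share j ≤ B) :
    ∃ S : Schedule m, IsRun aug A I S := by
  classical
  -- `X c` are the completion times that result when the algorithm is told `c`. A run is a fixed
  -- point of `X` on the jobs.
  let X : (ℕ → ℝ≥0∞) → ℕ → ℝ≥0∞ := fun c => completionTime aug I fun t => A (obsOf I c t)
  suffices H : ∃ c, ∀ j ∈ I.jobs, X c j = c j by
    obtain ⟨c, hc⟩ := H
    refine ⟨fun t => A (obsOf I c t), fun t => ?_⟩
    rw [observe_eq_obsOf]
    exact congrArg A (obsOf_congr fun j hj _ _ => (hc j hj).symm)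
  -- `D` is a set of jobs whose completion times are known
  obtain ⟨D, hD, hmax⟩ := Finset.exists_max_image
    (I.jobs.powerset.filter fun D => ∃ (c : ℕ → ℝ≥0∞) (σ : ℝ≥0∞),
      (∀ j ∈ D, X c j = c j ∧ c j ≤ σ) ∧ ∀ j ∈ I.jobs \ D, c j = ∞ ∧ σ ≤ X c j) Finset.card
    ⟨∅, Finset.mem_filter.2 ⟨by simp, fun _ => ∞, 0, by simp, by simp⟩⟩
  simp only [Finset.mem_filter, Finset.mem_powerset] at hD hmax
  obtain ⟨hDI, c, σ, hc1, hc2⟩ := hD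
  by_cases hall : ∀ j ∈ I.jobs \ D, X c j = ∞
  · refine ⟨c, fun j hj => ?_⟩
    by_cases hjD : j ∈ D
    · exact (hc1 j hjD).1
    · have := Finset.mem_sdiff.2 ⟨hj, hjD⟩
      rw [hall j this, (hc2 j this).1]
  exfalso
  push Not at hall
  obtain ⟨j₁, hj₁, hj₁'⟩ := hall
  -- The first completion not yet announced is correct: announcing it changes no observation before
  -- it happens. Hence `D` could be enlarged by `j₀`.
  obtain ⟨j₀, hj₀, hmin⟩ := Finset.exists_min_image (I.jobs \ D) (X c) ⟨j₁, hj₁⟩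
  set τ := X c j₀
  have hτ : τ ≠ ∞ := ((hmin j₁ hj₁).trans_lt (lt_top_iff_ne_top.2 hj₁')).ne
  have hτT : ENNReal.ofReal τ.toReal = τ := ENNReal.ofReal_toReal hτ
  have hj₀I := (Finset.mem_sdiff.1 hj₀).1
  have hj₀D := (Finset.mem_sdiff.1 hj₀).2
  set c' := Function.update c j₀ τ
  have hagree : ∀ t < τ.toReal, A (obsOf I c t) = A (obsOf I c' t) := by
    intro t ht
    refine congrArg A (obsOf_congr fun j hj hr h => ?_)
    by_cases hjj : j = j₀
    · subst hjj
      have h1 : ¬ τ ≤ ENNReal.ofReal t := by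
        rw [not_le, ← hτT]
        exact (ENNReal.ofReal_lt_ofReal_iff_of_nonneg ((I.release_nonneg j hj).trans hr)).2 ht
      simp [c', (hc2 j hj₀).1, h1] at h
    · exact (Function.update_of_ne hjj _ _).symm
  have hle : ∀ j ∈ I.jobs, X c j ≤ τ → X c' j ≤ X c j := fun j hj h => by
    obtain ⟨B, hB⟩ := hA c j hj
    exact completionTime_le_of_eq_before hj hB ENNReal.toReal_nonneg hagree (by rwa [hτT])
  have hle' : ∀ j ∈ I.jobs, X c' j ≤ τ → X c j ≤ X c' j := fun j hj h => by
    obtain ⟨B, hB⟩ := hA c' j hj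
    exact completionTime_le_of_eq_before hj hB ENNReal.toReal_nonneg
      (fun t ht => (hagree t ht).symm) (by rwa [hτT])
  have heq : ∀ j ∈ I.jobs, X c j ≤ τ → X c' j = X c j := fun j hj h =>
    le_antisymm (hle j hj h) (hle' j hj ((hle j hj h).trans h))
  have hστ : σ ≤ τ := (hc2 j₀ hj₀).2
  have := hmax (insert j₀ D) ⟨Finset.insert_subset hj₀I hDI, c', τ, fun j hj => ?_,
    fun j hj => ?_⟩
  · rw [Finset.card_insert_of_notMem hj₀D] at this
    omega
  · by_cases hjj : j = j₀
    · subst hjj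
      rw [heq j hj₀I le_rfl]
      simp [c', τ]
    · have hjD := Finset.mem_of_mem_insert_of_ne hj hjj
      obtain ⟨h1, h2⟩ := hc1 j hjD
      have h3 : c' j = c j := Function.update_of_ne hjj _ _
      rw [h3, heq j (hDI hjD) (by rw [h1]; exact h2.trans hστ)]
      exact ⟨h1, h2.trans hστ⟩
  · have hjj : j ≠ j₀ := fun h => (Finset.mem_sdiff.1 hj).2 (h ▸ Finset.mem_insert_self _ _)
    have hjD : j ∈ I.jobs \ D := Finset.mem_sdiff.2 ⟨(Finset.mem_sdiff.1 hj).1,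
      fun h => (Finset.mem_sdiff.1 hj).2 (Finset.mem_insert_of_mem h)⟩
    refine ⟨by rw [show c' j = c j from Function.update_of_ne hjj _ _, (hc2 j hjD).1], ?_⟩
    by_contra! hlt
    have h1 := hle' j (Finset.mem_sdiff.1 hj).1 hlt.le
    exact absurd (hmin j hjD) (not_le.2 (h1.trans_lt hlt))

end Completion

/-! ### Feasibility and form of the runs. -/

section Run

variable {m : ℕ} [Nonempty (Fin m)] {f : Fin m → ℝ → ℝ} {k : ℕ} {δ aug : ℝ} {I : JobInstance m}
  {S : Schedule m}

theorem decisionOf_share {Q : Queues m} (hQ : ValidQueues I Q) {i : Fin m} {j : ℕ} (hj : j ∈ Q i) :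
    (decisionOf f k I.weight Q).share j = powerInv (f i) (listWeight I (Q i)) *
      (((aheadWeight I (Q i) j + I.weight j) ^ (k + 1) - aheadWeight I (Q i) j ^ (k + 1)) /
        listWeight I (Q i) ^ (k + 1)) := by
  have : Queued Q j := ⟨i, hj⟩
  simp only [decisionOf, this, if_true, hQ.machineOf_eq hj]
  rfl

theorem decisionOf_share_of_not_queued {Q : Queues m} {j : ℕ} (hj : ¬ Queued Q j) :
    (decisionOf f k I.weight Q).share j = 0 := by
  simp only [decisionOf, hj, if_false]

theorem decisionOf_share_nonneg (hf : ∀ i, IsPowerFunction (f i)) {Q : Queues m}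
    (hQ : ValidQueues I Q) (j : ℕ) : 0 ≤ (decisionOf f k I.weight Q).share j := by
  by_cases hj : Queued Q j
  · obtain ⟨i, hi⟩ := hj
    rw [decisionOf_share hQ hi]
    have h1 := listWeight_nonneg (fun a ha => hQ.mem_jobs (i := i) (j := a) ha)
    have h2 := (hf i).powerInv_nonneg h1
    have h3 := aheadWeight_nonneg (fun a ha => hQ.mem_jobs (i := i) (j := a) ha) j
    have h4 := I.weight_pos j (hQ.mem_jobs hi)
    have h5 : aheadWeight I (Q i) j ^ (k + 1) ≤ (aheadWeight I (Q i) j + I.weight j) ^ (k + 1) := by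
      gcongr; linarith
    have := sub_nonneg.2 h5
    positivity
  · rw [decisionOf_share_of_not_queued hj]

theorem sum_decisionOf_share_le (hf : ∀ i, IsPowerFunction (f i)) {Q : Queues m}
    (hQ : ValidQueues I Q) (i : Fin m) :
    ∑ j ∈ (Q i).toFinset, (decisionOf f k I.weight Q).share j ≤
      (decisionOf f k I.weight Q).speed i := by
  have h1 := listWeight_nonneg (fun a ha => hQ.mem_jobs (i := i) (j := a) ha)
  have h2 := (hf i).powerInv_nonneg h1
  change _ ≤ powerInv (f i) (listWeight I (Q i))
  rw [Finset.sum_congr rfl fun j hj => decisionOf_share hQ (List.mem_toFinset.1 hj),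
    ← Finset.mul_sum, ← Finset.sum_div,
    sum_ahead_telescope (fun x => x ^ (k + 1)) (hQ.nodup i)]
  simp only [ne_eq, Nat.add_eq_zero_iff, one_ne_zero, and_false, not_false_eq_true, zero_pow,
    sub_zero]
  -- The shares use the full speed if the queue has positive weight; the inequality also covers the
  -- empty queue, where the quotient is `0 / 0`.
  exact mul_le_of_le_one_right h2 (div_self_le_one _)

theorem isRun_eq (hf : ∀ i, IsPowerFunction (f i)) (hδ : 0 ≤ δ)
    (hS : IsRun aug (selfishMigrateEnergy f k δ) I S) (t : ℝ) :
    S t = decisionOf f k I.weight (queueAt f δ I (completionTime aug I S) t) := by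
  rw [hS t, observe_eq_obsOf, selfishMigrateEnergy_obsOf hf k hδ]

/-- For given completion times the queues take finitely many values, so the processing rates are
bounded. -/
theorem exists_isRun_selfishMigrateEnergy (hf : ∀ i, IsPowerFunction (f i)) (k : ℕ) (hδ : 0 ≤ δ)
    (aug : ℝ) (I : JobInstance m) : ∃ S, IsRun aug (selfishMigrateEnergy f k δ) I S := by
  refine exists_isRun _ fun c j _ => ?_
  simp only [selfishMigrateEnergy_obsOf hf k hδ]
  exact exists_forall_queueAt_le f δ I c fun Q => aug *
    I.rate ((decisionOf f k I.weight Q).machine j) j * (decisionOf f k I.weight Q).share j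

theorem isFeasible_of_isRun (hf : ∀ i, IsPowerFunction (f i)) (hδ : 0 ≤ δ)
    (hS : IsRun aug (selfishMigrateEnergy f k δ) I S) : IsFeasible I S := by
  have hSt := isRun_eq hf hδ hS
  have hinv := queueInvariant_queueAt hf hδ I (completionTime aug I S)
  refine ⟨fun j _ => ?_, fun j _ => ?_, fun i => ?_, fun j _ t => ?_, fun i t => ?_, fun i t => ?_⟩
  · simp only [hSt]
    exact measurable_comp_queueAt f δ I _ fun Q => (decisionOf f k I.weight Q).machine j
  · simp only [hSt]
    exact measurable_comp_queueAt f δ I _ fun Q => (decisionOf f k I.weight Q).share j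
  · simp only [hSt]
    exact measurable_comp_queueAt f δ I _ fun Q => (decisionOf f k I.weight Q).speed i
  · rw [hSt]
    exact decisionOf_share_nonneg hf (hinv t).valid j
  · rw [hSt]
    exact (hf i).powerInv_nonneg (listWeight_nonneg fun a ha => (hinv t).valid.mem_jobs ha)
  · rw [hSt]
    refine le_trans ?_ (sum_decisionOf_share_le hf (hinv t).valid i)
    set Q := queueAt f δ I (completionTime aug I S) t
    have hQ := (hinv t).valid
    refine le_of_eq (Finset.sum_subset_zero_on_sdiff ?_ ?_ fun _ _ => rfl).symm
    · intro j hj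
      have hj' := List.mem_toFinset.1 hj
      exact Finset.mem_filter.2 ⟨hQ.mem_jobs hj', hQ.machineOf_eq hj'⟩
    · intro j hj
      rw [Finset.mem_sdiff, Finset.mem_filter] at hj
      refine decisionOf_share_of_not_queued fun hq => hj.2 (List.mem_toFinset.2 ?_)
      have : machineOf Q j = i := hj.1.2
      exact this ▸ mem_machineOf hq

theorem isSelfishMigrateEnergy_of_isRun (hf : ∀ i, IsPowerFunction (f i)) (hδ : 0 ≤ δ)
    (hS : IsRun aug (selfishMigrateEnergy f k δ) I S) :
    IsSelfishMigrateEnergy aug f k δ I S (queueAt f δ I (completionTime aug I S)) := by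
  have hSt := isRun_eq hf hδ hS
  have hinv := queueInvariant_queueAt hf hδ I (completionTime aug I S)
  refine ⟨fun t i => (hinv t).valid.nodup i, fun t i j => ?_, fun t i => ?_, fun t i j hj => ?_,
    fun t => (hinv t).equilibrium, fun t => ?_⟩
  · have hq : Queued _ j ↔ IsActive aug I S j t := (hinv t).queued_iff j
    rw [hSt]
    constructor
    · exact fun h => ⟨hq.1 ⟨i, h⟩, (hinv t).valid.machineOf_eq h⟩
    · rintro ⟨h, h'⟩
      exact h' ▸ mem_machineOf (hq.2 h)
  · have := listWeight_nonneg (fun a ha => (hinv t).valid.mem_jobs (i := i) (j := a) ha)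
    rw [hSt]
    exact ⟨(hf i).powerInv_nonneg this, (hf i).apply_powerInv this⟩
  · rw [hSt]
    exact decisionOf_share (hinv t).valid hj
  · obtain ⟨P, η, h1, h2, h3, h4⟩ := queueAt_dynamics hf hδ I (completionTime aug I S) t
    exact ⟨P, η, h1, h2, h3, h4 _ fun j => @decide_eq_true_iff _ (Classical.propDecidable _)⟩

end Run

/-! ### The number of migrations. -/

section

variable {m : ℕ}

theorem sum_weight_div_le {I : JobInstance m} {j : ℕ} (hj : j ∈ I.jobs) :
    (∑ a ∈ I.jobs, I.weight a) / I.weight j ≤ I.jobs.card * I.weightRatio := by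
  set A := I.weight '' (I.jobs : Set ℕ)
  have hfin : A.Finite := I.jobs.finite_toSet.image _
  have hne : A.Nonempty := ⟨_, j, hj, rfl⟩
  have hinf : 0 < sInf A := by
    obtain ⟨a, ha, h⟩ := hne.csInf_mem hfin
    rw [← h]
    exact I.weight_pos a ha
  have h1 : ∀ a ∈ I.jobs, I.weight a ≤ sSup A := fun a ha => le_csSup hfin.bddAbove ⟨a, ha, rfl⟩
  have h2 : sInf A ≤ I.weight j := csInf_le hfin.bddBelow ⟨j, hj, rfl⟩
  have h3 : ∑ a ∈ I.jobs, I.weight a ≤ I.jobs.card * sSup A := by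
    simpa using Finset.sum_le_card_nsmul _ _ _ h1
  have h4 : 0 < I.weight j := I.weight_pos j hj
  calc (∑ a ∈ I.jobs, I.weight a) / I.weight j ≤ (I.jobs.card * sSup A) / I.weight j := by gcongr
    _ ≤ (I.jobs.card * sSup A) / sInf A := by
      have := h4.le.trans (h1 j hj)
      gcongr
    _ = _ := mul_div_assoc _ _ _

theorem one_le_weightRatio {I : JobInstance m} {j : ℕ} (hj : j ∈ I.jobs) : 1 ≤ I.weightRatio := by
  set A := I.weight '' (I.jobs : Set ℕ)
  have hfin : A.Finite := I.jobs.finite_toSet.image _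
  have hne : A.Nonempty := ⟨_, j, hj, rfl⟩
  have hinf : 0 < sInf A := by
    obtain ⟨a, ha, h⟩ := hne.csInf_mem hfin
    rw [← h]
    exact I.weight_pos a ha
  exact (one_le_div hinf).2 ((csInf_le hfin.bddBelow ⟨j, hj, rfl⟩).trans
    (le_csSup hfin.bddAbove ⟨j, hj, rfl⟩))

/-- Removing the weight ahead lowers `g`, so the utility gains at most the factor from the
denominator, which is `(x + w) / w`. -/
theorem utility_zero_le {f : Fin m → ℝ → ℝ} {I : JobInstance m}
    (hf : ∀ i, IsPowerFunction (f i)) (i : Fin m) {j : ℕ} (hj : j ∈ I.jobs)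
    {x B : ℝ} (hx : 0 ≤ x) (hB : x + I.weight j ≤ B) :
    utility f I i j 0 ≤ B / I.weight j * utility f I i j x := by
  have hw := I.weight_pos j hj
  have hr := I.rate_nonneg i j hj
  have hg := (hf i).powerInv_mono hw.le (show I.weight j ≤ x + I.weight j by linarith)
  have hg0 := (hf i).powerInv_nonneg hw.le
  have hxw : 0 < x + I.weight j := by linarith
  unfold utility
  rw [zero_add]
  calc powerInv (f i) (I.weight j) * (I.rate i j / I.weight j)
      ≤ powerInv (f i) (x + I.weight j) * (I.rate i j / I.weight j) := by gcongr
    _ = (x + I.weight j) / I.weight j *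
        (powerInv (f i) (x + I.weight j) * (I.rate i j / (x + I.weight j))) := by
      field_simp
    _ ≤ _ := by
      have := hg0.trans hg
      gcongr

variable [Nonempty (Fin m)] {f : Fin m → ℝ → ℝ} {k : ℕ} {δ aug : ℝ} {I : JobInstance m}
  {S : Schedule m}

/-- In equilibrium the utility of a job is not much smaller than its utility on an empty machine. -/
theorem QueueInvariant.utility_zero_le {c : ℕ → ℝ≥0∞} {t : ℝ} {Q : Queues m}
    (hQ : QueueInvariant f δ I c t Q) (hf : ∀ i, IsPowerFunction (f i)) (hδ : 0 ≤ δ) {j : ℕ}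
    (hj : Queued Q j) (d : Fin m) :
    utility f I d j 0 ≤
      (∑ a ∈ I.jobs, I.weight a) / I.weight j * ((1 + δ) * jobUtility f I Q j) := by
  obtain ⟨i, hi⟩ := hj
  have hjI := hQ.valid.mem_jobs hi
  have hu := jobUtility_nonneg hf hQ.valid ⟨i, hi⟩
  have hK : 0 ≤ (∑ a ∈ I.jobs, I.weight a) / I.weight j :=
    div_nonneg (Finset.sum_nonneg fun a ha => (I.weight_pos a ha).le) (I.weight_pos j hjI).le
  have hmem : ∀ {e}, ∀ a ∈ Q e, a ∈ I.jobs := fun a ha => hQ.valid.mem_jobs ha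
  by_cases hd : d = i
  · subst hd
    refine (FlowEnergy.utility_zero_le hf d hjI (aheadWeight_nonneg hmem j)
      ((aheadWeight_add_le hmem hi).trans (listWeight_le_sum (hQ.valid.nodup d) hmem))).trans ?_
    rw [← jobUtility_eq hQ.valid hi]
    refine mul_le_mul_of_nonneg_left ?_ hK
    nlinarith
  · have hnot : j ∉ Q d := fun h => hd (hQ.valid.inj h hi)
    refine (FlowEnergy.utility_zero_le hf d hjI (listWeight_nonneg (hmem (e := d)))
      (B := ∑ a ∈ I.jobs, I.weight a) ?_).trans ?_
    · rw [← listWeight_singleton, ← listWeight_append]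
      refine listWeight_le_sum ((hQ.valid.nodup d).append (List.nodup_singleton j)
        (by simpa using hnot)) fun a ha => ?_
      rcases List.mem_append.1 ha with h | h
      · exact hmem a h
      · rw [List.mem_singleton.1 h]; exact hjI
    · refine mul_le_mul_of_nonneg_left ?_ hK
      rw [jobUtility_eq hQ.valid hi]
      exact hQ.equilibrium i j hi d hd

/-- Each change gains a factor above `1 + δ`. The final utility is at most that on an empty machine,
which the equilibrium at the first instant compares with the initial utility. -/
theorem pow_lt_of_machine_changes (hf : ∀ i, IsPowerFunction (f i)) (hδ : 0 ≤ δ)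
    (hS : IsRun aug (selfishMigrateEnergy f k δ) I S) {j : ℕ} (hj : j ∈ I.jobs) {n : ℕ}
    (hn : 0 < n) {t : Fin (n + 1) → ℝ} (ht : StrictMono t) (hact : ∀ a, IsActive aug I S j (t a))
    (hne : ∀ a : Fin n, (S (t a.castSucc)).machine j ≠ (S (t a.succ)).machine j) :
    (1 + δ) ^ n < I.jobs.card * I.weightRatio * (1 + δ) := by
  set Q := queueAt f δ I (completionTime aug I S)
  have hinv := queueInvariant_queueAt hf hδ I (completionTime aug I S)
  have hmach : ∀ s, (S s).machine j = machineOf (Q s) j := fun s => by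
    rw [isRun_eq hf hδ hS]; rfl
  have hq : ∀ a, Queued (Q (t a)) j := fun a => ((hinv (t a)).queued_iff j).2 (hact a)
  have h0 : 0 ≤ jobUtility f I (Q (t 0)) j := jobUtility_nonneg hf (hinv (t 0)).valid (hq 0)
  have key : ∀ a (ha : a < n + 1),
      (1 + δ) ^ a * jobUtility f I (Q (t 0)) j ≤ jobUtility f I (Q (t ⟨a, ha⟩)) j ∧
      (0 < a → (1 + δ) ^ a * jobUtility f I (Q (t 0)) j < jobUtility f I (Q (t ⟨a, ha⟩)) j) := by
    intro a
    induction a with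
    | zero => intro ha; simp
    | succ a ih =>
      intro ha
      have ih' := (ih (by omega)).1
      have hne' := hne ⟨a, by omega⟩
      rw [hmach, hmach] at hne'
      have himp := improvesFor_queueAt hf hδ (c := completionTime aug I S)
        (ht (Fin.castSucc_lt_succ (i := (⟨a, by omega⟩ : Fin n)))).le
        (hact (Fin.castSucc ⟨a, by omega⟩)).2.1 (hact _)
      have h1 := himp.2 hne'
      have h2 : (1 + δ) ^ (a + 1) * jobUtility f I (Q (t 0)) j <
          jobUtility f I (Q (t ⟨a + 1, ha⟩)) j := by
        refine lt_of_le_of_lt ?_ h1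
        rw [pow_succ', mul_assoc]
        exact mul_le_mul_of_nonneg_left ih' (by linarith)
      exact ⟨h2.le, fun _ => h2⟩
  have h1 := (key n (by omega)).2 hn
  set t' := t ⟨n, by omega⟩
  obtain ⟨i, hi⟩ := hq ⟨n, by omega⟩
  have h2 : jobUtility f I (Q t') j ≤ utility f I i j 0 := by
    rw [jobUtility_eq (hinv t').valid hi]
    exact utility_anti hf i hj le_rfl (aheadWeight_nonneg (fun a ha => (hinv t').valid.mem_jobs ha) j)
  have h3 := (hinv (t 0)).utility_zero_le hf hδ (hq 0) i
  have h4 : (1 + δ) ^ n * jobUtility f I (Q (t 0)) j <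
      I.jobs.card * I.weightRatio * (1 + δ) * jobUtility f I (Q (t 0)) j := by
    refine (h1.trans_le (h2.trans h3)).trans_le ?_
    rw [mul_assoc _ (1 + δ)]
    exact mul_le_mul_of_nonneg_right (sum_weight_div_le hj) (mul_nonneg (by linarith) h0)
  exact lt_of_mul_lt_mul_right h4 h0

theorem migrations_le (hf : ∀ i, IsPowerFunction (f i)) (hk : 0 < k)
    (hS : IsRun aug (selfishMigrateEnergy f k (1 / (k : ℝ))) I S) {j : ℕ} (hj : j ∈ I.jobs) :
    ((migrations aug I S j : ℕ∞) : ENNReal) ≤ ENNReal.ofReal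
      ((k + 3) * (Real.log I.weightRatio + Real.log (I.jobs.card : ℝ))) := by
  have hkR : (0 : ℝ) < k := by exact_mod_cast hk
  have hδ : 0 < 1 / (k : ℝ) := by positivity
  have hW := one_le_weightRatio hj
  have hN : 1 ≤ I.jobs.card := Finset.card_pos.2 ⟨j, hj⟩
  have hN' : (1 : ℝ) ≤ I.jobs.card := by exact_mod_cast hN
  set L := Real.log I.weightRatio + Real.log (I.jobs.card : ℝ)
  have hL : 0 ≤ L := add_nonneg (Real.log_nonneg hW) (Real.log_nonneg hN')
  have hLeq : Real.log (I.jobs.card * I.weightRatio) = L := by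
    rw [Real.log_mul (by positivity) (by positivity)]; exact add_comm _ _
  have hmain : ∀ n : ℕ, (∃ t : Fin (n + 1) → ℝ, StrictMono t ∧ (∀ a, IsActive aug I S j (t a)) ∧
      ∀ a : Fin n, (S (t a.castSucc)).machine j ≠ (S (t a.succ)).machine j) →
      (n : ℝ) ≤ (k + 3) * L := by
    rintro n ⟨t, h1, h2, h3⟩
    rcases Nat.eq_zero_or_pos n with rfl | hn
    · simp only [CharP.cast_eq_zero]; positivity
    have hlt := pow_lt_of_machine_changes hf hδ.le hS hj hn h1 h2 h3
    have hn1 : (1 : ℝ) ≤ n := by exact_mod_cast hn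
    have hlog := Real.log_lt_log (by positivity) hlt
    rw [Real.log_pow, Real.log_mul (by positivity) (by positivity), hLeq] at hlog
    have hl : 1 / ((k : ℝ) + 1) ≤ Real.log (1 + 1 / (k : ℝ)) := by
      have := Real.one_sub_inv_le_log_of_pos (show 0 < 1 + 1 / (k : ℝ) by positivity)
      refine le_trans (le_of_eq ?_) this
      field_simp
      ring
    set l := Real.log (1 + 1 / (k : ℝ))
    have h5 : ((n : ℝ) - 1) ≤ (k + 1) * L := by
      have h6 : ((n : ℝ) - 1) * (1 / ((k : ℝ) + 1)) ≤ L := by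
        have : ((n : ℝ) - 1) * (1 / ((k : ℝ) + 1)) ≤ (n - 1) * l := by
          have : 0 ≤ (n : ℝ) - 1 := by linarith
          gcongr
        linarith
      rw [mul_one_div, div_le_iff₀ (by positivity)] at h6
      linarith
    -- A single job cannot move: the bound would read `(1 + δ) ^ n < 1 + δ`. With two jobs, `1 ≤ 2 *
    -- log 2 ≤ 2 * L` absorbs the extra 1 and turns `k + 1` into `k + 3`.
    have hN2 : 2 ≤ I.jobs.card := by
      by_contra! h
      have hc : I.jobs.card = 1 := by omega
      have hW1 : I.weightRatio = 1 := by
        obtain ⟨a, ha⟩ := Finset.card_eq_one.1 hc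
        rw [JobInstance.weightRatio, ha]
        have : a = j := by rw [ha, Finset.mem_singleton] at hj; exact hj.symm
        subst this
        simpa using div_self (I.weight_pos a hj).ne'
      have hL0 : L = 0 := by simp [L, hc, hW1]
      have hl0 : 0 < l := lt_of_lt_of_le (by positivity) hl
      rw [hL0] at hlog
      nlinarith
    have h6 : Real.log 2 ≤ L := by
      have : Real.log 2 ≤ Real.log (I.jobs.card : ℝ) :=
        Real.log_le_log (by norm_num) (by exact_mod_cast hN2)
      have := Real.log_nonneg hW
      simp only [L]; linarith
    have := Real.log_two_gt_d9
    nlinarith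
  have hfloor : migrations aug I S j ≤ ((⌊((k : ℝ) + 3) * L⌋₊ : ℕ) : ℕ∞) := by
    refine iSup₂_le fun n hn => ?_
    exact_mod_cast Nat.le_floor (hmain n hn)
  calc ((migrations aug I S j : ℕ∞) : ENNReal) ≤ ((⌊((k : ℝ) + 3) * L⌋₊ : ℕ) : ENNReal) := by
        exact_mod_cast ENat.toENNReal_mono hfloor
    _ = ENNReal.ofReal (⌊((k : ℝ) + 3) * L⌋₊ : ℝ) := (ENNReal.ofReal_natCast _).symm
    _ ≤ _ := ENNReal.ofReal_le_ofReal (Nat.floor_le (by positivity))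

end

/-! ### Pointwise bounds on the dual rates. -/

section DualRate

variable {m : ℕ} [Nonempty (Fin m)] {f : Fin m → ℝ → ℝ} {k : ℕ} {δ : ℝ} {I : JobInstance m}
  {Q : Queues m}

/-- The total weight of all queued jobs. -/
def totalWeight (I : JobInstance m) (Q : Queues m) : ℝ := ∑ i, listWeight I (Q i)

/-- The rate at which the dual variable of a job grows. -/
def dualRate (f : Fin m → ℝ → ℝ) (k : ℕ) (I : JobInstance m) (Q : Queues m) (j : ℕ) : ℝ :=
  let y := aheadWeight I (Q (machineOf Q j)) j + I.weight j
  (decisionOf f k I.weight Q).share j * (y / powerInv (f (machineOf Q j)) y) / (k + 1)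

theorem dualRate_eq (hQ : ValidQueues I Q) {i : Fin m} {j : ℕ} (hj : j ∈ Q i) :
    dualRate f k I Q j = (decisionOf f k I.weight Q).share j *
      ((aheadWeight I (Q i) j + I.weight j) / powerInv (f i) (aheadWeight I (Q i) j + I.weight j)) /
      (k + 1) := by
  simp only [dualRate, hQ.machineOf_eq hj]

theorem dualRate_of_not_queued {j : ℕ} (hj : ¬ Queued Q j) : dualRate f k I Q j = 0 := by
  simp [dualRate, decisionOf_share_of_not_queued hj]

theorem dualRate_nonneg (hf : ∀ i, IsPowerFunction (f i)) (hQ : ValidQueues I Q) (j : ℕ) :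
    0 ≤ dualRate f k I Q j := by
  by_cases hj : Queued Q j
  · obtain ⟨i, hi⟩ := hj
    rw [dualRate_eq hQ hi]
    have h1 := decisionOf_share_nonneg (k := k) hf hQ j
    have h2 := aheadWeight_nonneg (fun a ha => hQ.mem_jobs (i := i) (j := a) ha) j
    have h3 := I.weight_pos j (hQ.mem_jobs hi)
    have h4 := (hf i).powerInv_pos (x := aheadWeight I (Q i) j + I.weight j) (by linarith)
    positivity
  · rw [dualRate_of_not_queued hj]

/-- Replacing `y / g y` by its value at the whole queue weight cancels the speed. The mean value
bound for `x ^ (k + 1)` then gives the weight, the factor `k + 1` cancelling. -/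
theorem dualRate_le_weight (hf : ∀ i, IsPowerFunction (f i)) (hQ : ValidQueues I Q) {j : ℕ}
    (hj : Queued Q j) : dualRate f k I Q j ≤ I.weight j := by
  obtain ⟨i, hi⟩ := hj
  rw [dualRate_eq hQ hi, decisionOf_share hQ hi]
  have hmem : ∀ a ∈ Q i, a ∈ I.jobs := fun a ha => hQ.mem_jobs ha
  have ha := aheadWeight_nonneg hmem j
  have hw := I.weight_pos j (hQ.mem_jobs hi)
  have hyW := aheadWeight_add_le hmem hi
  set a := aheadWeight I (Q i) j
  set W := listWeight I (Q i)
  set w := I.weight j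
  have hy : 0 < a + w := by linarith
  have hW : 0 < W := by linarith
  have hgW := (hf i).powerInv_pos hW
  have hgy := (hf i).powerInv_pos hy
  have h1 := (hf i).div_powerInv_mono hy hyW
  have h2 := pow_succ_sub_le k ha (show a ≤ a + w by linarith)
  rw [add_sub_cancel_left] at h2
  have h3 : (a + w) ^ k ≤ W ^ k := by gcongr
  rw [div_le_iff₀ (by positivity)]
  have hd : 0 ≤ (a + w) ^ (k + 1) - a ^ (k + 1) := by
    have : a ^ (k + 1) ≤ (a + w) ^ (k + 1) := by gcongr; linarith
    linarith
  calc powerInv (f i) W * (((a + w) ^ (k + 1) - a ^ (k + 1)) / W ^ (k + 1)) *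
        ((a + w) / powerInv (f i) (a + w))
      ≤ powerInv (f i) W * (((a + w) ^ (k + 1) - a ^ (k + 1)) / W ^ (k + 1)) *
        (W / powerInv (f i) W) := by gcongr
    _ = ((a + w) ^ (k + 1) - a ^ (k + 1)) / W ^ k := by
      rw [pow_succ W]; field_simp
    _ ≤ ((k + 1) * (w * W ^ k)) / W ^ k := by
      have : (k + 1 : ℝ) * (w * (a + w) ^ k) ≤ (k + 1) * (w * W ^ k) := by gcongr
      gcongr
      exact h2.trans this
    _ = w * (k + 1) := by field_simp

/-- As `g y ≤ g W`, the factor `g W / g y` can be dropped. The remaining terms dominate differences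
of `(k + 2)`-nd powers that telescope to `W ^ (k + 2) / W ^ (k + 1) = W`. -/
theorem listWeight_le_sum_dualRate (hf : ∀ i, IsPowerFunction (f i)) (hQ : ValidQueues I Q)
    (i : Fin m) :
    listWeight I (Q i) ≤ (k + 2) * ∑ j ∈ (Q i).toFinset, dualRate f k I Q j := by
  have hmem : ∀ a ∈ Q i, a ∈ I.jobs := fun a ha => hQ.mem_jobs ha
  have hW0 := listWeight_nonneg hmem
  rcases eq_or_lt_of_le hW0 with h | hW
  · rw [← h]
    exact mul_nonneg (by positivity) (Finset.sum_nonneg fun j _ => dualRate_nonneg hf hQ j)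
  have htel := sum_ahead_telescope (I := I) (fun x => x ^ (k + 2)) (hQ.nodup i)
  set W := listWeight I (Q i)
  have hgW := (hf i).powerInv_pos hW
  have hterm : ∀ j ∈ (Q i).toFinset, ((aheadWeight I (Q i) j + I.weight j) ^ (k + 2) -
      aheadWeight I (Q i) j ^ (k + 2)) / W ^ (k + 1) ≤ (k + 2) * dualRate f k I Q j := by
    intro j hj
    have hi := List.mem_toFinset.1 hj
    rw [dualRate_eq hQ hi, decisionOf_share hQ hi]
    have ha := aheadWeight_nonneg hmem j
    have hw := I.weight_pos j (hQ.mem_jobs hi)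
    have hyW := aheadWeight_add_le hmem hi
    set a := aheadWeight I (Q i) j
    set w := I.weight j
    have hy : 0 < a + w := by linarith
    have hgy := (hf i).powerInv_pos hy
    have h1 := (hf i).powerInv_mono hy.le hyW
    have h2 := pow_succ_sub_mul_le k ha (show a ≤ a + w by linarith)
    have hd : 0 ≤ (a + w) ^ (k + 1) - a ^ (k + 1) := by
      have : a ^ (k + 1) ≤ (a + w) ^ (k + 1) := by gcongr; linarith
      linarith
    have h3 : 1 ≤ powerInv (f i) W / powerInv (f i) (a + w) := (one_le_div hgy).2 h1
    change _ ≤ (k + 2 : ℝ) * (powerInv (f i) W *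
      (((a + w) ^ (k + 1) - a ^ (k + 1)) / W ^ (k + 1)) *
        ((a + w) / powerInv (f i) (a + w)) / (k + 1))
    calc ((a + w) ^ (k + 2) - a ^ (k + 2)) / W ^ (k + 1)
        ≤ ((k + 2) / (k + 1) * (((a + w) ^ (k + 1) - a ^ (k + 1)) * (a + w))) / W ^ (k + 1) := by
          gcongr
          rw [div_mul_eq_mul_div, le_div_iff₀ (by positivity)]
          linarith
      _ ≤ ((k + 2) / (k + 1) * (((a + w) ^ (k + 1) - a ^ (k + 1)) * (a + w))) / W ^ (k + 1) *
          (powerInv (f i) W / powerInv (f i) (a + w)) :=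
        le_mul_of_one_le_right (by positivity) h3
      _ = _ := by field_simp
  have hsum := Finset.sum_le_sum hterm
  rw [← Finset.sum_div, htel, ← Finset.mul_sum] at hsum
  refine le_trans (le_of_eq ?_) hsum
  rw [zero_pow (by omega), sub_zero, pow_succ W (k + 1)]
  field_simp

theorem sum_toFinset_eq (hQ : ValidQueues I Q) (i : Fin m) {φ : ℕ → ℝ}
    (hφ : ∀ j, ¬ Queued Q j → φ j = 0) :
    ∑ j ∈ (Q i).toFinset, φ j = ∑ j ∈ I.jobs.filter (fun j => machineOf Q j = i), φ j := by
  refine Finset.sum_subset_zero_on_sdiff ?_ ?_ fun _ _ => rfl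
  · intro j hj
    have hj' := List.mem_toFinset.1 hj
    exact Finset.mem_filter.2 ⟨hQ.mem_jobs hj', hQ.machineOf_eq hj'⟩
  · intro j hj
    rw [Finset.mem_sdiff, Finset.mem_filter] at hj
    refine hφ j fun hq => hj.2 (List.mem_toFinset.2 ?_)
    exact hj.1.2 ▸ mem_machineOf hq

theorem sum_sum_toFinset_eq (hQ : ValidQueues I Q) {φ : ℕ → ℝ}
    (hφ : ∀ j, ¬ Queued Q j → φ j = 0) :
    ∑ i, ∑ j ∈ (Q i).toFinset, φ j = ∑ j ∈ I.jobs, φ j := by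
  rw [Finset.sum_congr rfl fun i _ => sum_toFinset_eq hQ i hφ, Finset.sum_fiberwise]

theorem totalWeight_le_sum_dualRate (hf : ∀ i, IsPowerFunction (f i)) (hQ : ValidQueues I Q) :
    totalWeight I Q ≤ (k + 2) * ∑ j ∈ I.jobs, dualRate f k I Q j := by
  rw [← sum_sum_toFinset_eq hQ fun j => dualRate_of_not_queued, Finset.mul_sum]
  exact Finset.sum_le_sum fun i _ => listWeight_le_sum_dualRate hf hQ i

open Classical in
theorem totalWeight_eq_sum (hQ : ValidQueues I Q) :
    totalWeight I Q = ∑ j ∈ I.jobs, if Queued Q j then I.weight j else 0 := by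
  rw [← sum_sum_toFinset_eq hQ fun j hj => if_neg hj]
  refine Finset.sum_congr rfl fun i _ => ?_
  rw [listWeight_eq_sum (hQ.nodup i)]
  refine Finset.sum_congr rfl fun j hj => (if_pos ⟨i, List.mem_toFinset.1 hj⟩).symm

/-- If a job prefers its position to the tail of a queue of weight `x` on machine `i`, then its
dual variable grows slowly in comparison with its processing. -/
theorem rate_mul_dualRate_le (hf : ∀ i, IsPowerFunction (f i)) (hδ : 0 ≤ δ) (hQ : ValidQueues I Q)
    {j : ℕ} (hj : Queued Q j) (i : Fin m) {x : ℝ} (hx : 0 ≤ x)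
    (h : utility f I i j x ≤ (1 + δ) * jobUtility f I Q j) :
    I.rate i j * dualRate f k I Q j ≤ (1 + δ) / (k + 1) *
      (x / powerInv (f i) x + I.weight j / powerInv (f i) (I.weight j)) *
      (I.rate ((decisionOf f k I.weight Q).machine j) j * (decisionOf f k I.weight Q).share j) := by
  obtain ⟨i', hi'⟩ := hj
  rw [dualRate_eq hQ hi', show (decisionOf f k I.weight Q).machine j = i' from
    hQ.machineOf_eq hi']
  rw [jobUtility_eq hQ hi'] at h
  have hjI := hQ.mem_jobs hi'
  have hmem : ∀ a ∈ Q i', a ∈ I.jobs := fun a ha => hQ.mem_jobs ha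
  have ha := aheadWeight_nonneg hmem j
  have hw := I.weight_pos j hjI
  have hsh := decisionOf_share_nonneg (k := k) hf hQ j
  set s := (decisionOf f k I.weight Q).share j
  set a := aheadWeight I (Q i') j
  set w := I.weight j
  have hy : 0 < a + w := by linarith
  have hY : 0 < x + w := by linarith
  have hgy := (hf i').powerInv_pos hy
  have hgY := (hf i).powerInv_pos hY
  have hsub := (hf i).add_div_powerInv_le hx hw
  have hr' := I.rate_nonneg i' j hjI
  unfold utility at h
  -- The equilibrium inequality multiplied by the reciprocals of `g y / y` on both machines; this
  -- form remains meaningful when rates vanish.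
  have h1 : I.rate i j * ((a + w) / powerInv (f i') (a + w)) ≤
      (1 + δ) * I.rate i' j * ((x + w) / powerInv (f i) (x + w)) := by
    have := mul_le_mul_of_nonneg_right h (show 0 ≤ ((a + w) / powerInv (f i') (a + w)) *
      ((x + w) / powerInv (f i) (x + w)) by positivity)
    refine le_trans (le_of_eq ?_) (this.trans (le_of_eq ?_))
    · change _ = powerInv (f i) (x + w) * (I.rate i j / (x + w)) * _
      field_simp
    · change (1 + δ) * (powerInv (f i') (a + w) * (I.rate i' j / (a + w))) * _ = _
      field_simp
  have h2 : I.rate i j * ((a + w) / powerInv (f i') (a + w)) ≤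
      (1 + δ) * I.rate i' j * (x / powerInv (f i) x + w / powerInv (f i) w) :=
    h1.trans (mul_le_mul_of_nonneg_left hsub (by positivity))
  calc I.rate i j * (s * ((a + w) / powerInv (f i') (a + w)) / (k + 1))
      = I.rate i j * ((a + w) / powerInv (f i') (a + w)) * (s / (k + 1)) := by ring
    _ ≤ (1 + δ) * I.rate i' j * (x / powerInv (f i) x + w / powerInv (f i) w) * (s / (k + 1)) := by
      gcongr
    _ = _ := by ring

end DualRate

/-! ### Integrated dual variables and the cost of the algorithm. -/

section

/-- Lower integrals are superadditive, so this direction needs no measurability of the prices. -/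
theorem sum_lintegral_le {α ι : Type*} [MeasurableSpace α] (μ : Measure α) (s : Finset ι)
    (φ : ι → α → ℝ≥0∞) : ∑ i ∈ s, ∫⁻ a, φ i a ∂μ ≤ ∫⁻ a, ∑ i ∈ s, φ i a ∂μ := by
  classical
  induction s using Finset.induction_on with
  | empty => simp
  | insert i s hi ih =>
    simp only [Finset.sum_insert hi]
    exact (add_le_add le_rfl ih).trans (le_lintegral_add _ _)

section Algorithm

variable {m : ℕ} {f : Fin m → ℝ → ℝ} {k : ℕ} {δ aug : ℝ} {I : JobInstance m}
  {S : Schedule m}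

/-- The queues of a run. -/
def runQueues (f : Fin m → ℝ → ℝ) (δ aug : ℝ) (I : JobInstance m) (S : Schedule m) (t : ℝ) :
    Queues m :=
  queueAt f δ I (completionTime aug I S) t

theorem measurable_runQueues {α : Type*} [MeasurableSpace α] (φ : Queues m → α) :
    Measurable fun t => φ (runQueues f δ aug I S t) :=
  measurable_comp_queueAt f δ I _ φ

/-- The total weight of the active jobs until time `T`. -/
def weightUntil (f : Fin m → ℝ → ℝ) (δ aug : ℝ) (I : JobInstance m) (S : Schedule m) (T : ℝ) :
    ℝ≥0∞ :=
  ∫⁻ u in Set.Ioc 0 T, ENNReal.ofReal (totalWeight I (runQueues f δ aug I S u))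

theorem weightUntil_lt_top (T : ℝ) : weightUntil f δ aug I S T < ∞ := by
  obtain ⟨B, hB⟩ := exists_forall_queueAt_le f δ I (completionTime aug I S) (totalWeight I)
  calc weightUntil f δ aug I S T ≤ ∫⁻ _ in Set.Ioc 0 T, ENNReal.ofReal B :=
        lintegral_mono fun u => ENNReal.ofReal_le_ofReal (hB u)
    _ < ∞ := by
      rw [setLIntegral_const, Real.volume_Ioc]
      exact ENNReal.mul_lt_top ENNReal.ofReal_lt_top ENNReal.ofReal_lt_top

variable [Nonempty (Fin m)]

theorem runQueues_invariant (hf : ∀ i, IsPowerFunction (f i)) (hδ : 0 ≤ δ) (t : ℝ) :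
    QueueInvariant f δ I (completionTime aug I S) t (runQueues f δ aug I S t) :=
  queueInvariant_queueAt hf hδ I _ t

theorem queued_runQueues_iff (hf : ∀ i, IsPowerFunction (f i)) (hδ : 0 ≤ δ) {t : ℝ} {j : ℕ} :
    Queued (runQueues f δ aug I S t) j ↔ IsActive aug I S j t :=
  (runQueues_invariant hf hδ t).queued_iff j

theorem share_eq_zero_of_not_active (hf : ∀ i, IsPowerFunction (f i)) (hδ : 0 ≤ δ)
    (hS : IsRun aug (selfishMigrateEnergy f k δ) I S) {t : ℝ} {j : ℕ}
    (h : ¬ IsActive aug I S j t) : (S t).share j = 0 := by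
  rw [isRun_eq hf hδ hS]
  exact decisionOf_share_of_not_queued (mt (queued_runQueues_iff hf hδ).1 h)

/-- In total, at most the size of a job is processed. -/
theorem lintegral_rate_le_size (hf : ∀ i, IsPowerFunction (f i)) (hδ : 0 ≤ δ)
    (hS : IsRun aug (selfishMigrateEnergy f k δ) I S) (j : ℕ) :
    ∫⁻ u in Set.Ioi (I.release j),
      ENNReal.ofReal (aug * I.rate ((S u).machine j) j * (S u).share j) ≤
        ENNReal.ofReal (I.size j) := by
  set R : ℝ → ℝ≥0∞ := fun u => ENNReal.ofReal (aug * I.rate ((S u).machine j) j * (S u).share j)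
  -- Strictly before completion less than the size has been processed. Rational times exhaust the
  -- active period, also if the job never completes.
  let ι := {q : ℚ // ENNReal.ofReal q < completionTime aug I S j}
  have hsub : ∀ u, u ∈ Set.Ioi (I.release j) → u ∉ ⋃ q : ι, Set.Ioc (I.release j) (q.1 : ℝ) →
      R u = 0 := by
    intro u hu hnot
    have : ¬ IsActive aug I S j u := by
      rintro ⟨-, -, h⟩
      obtain ⟨q, hq0, hq1, hq2⟩ := ENNReal.lt_iff_exists_rat_btwn.1 h
      refine hnot (Set.mem_iUnion.2 ⟨⟨q, hq2⟩, hu, ?_⟩)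
      exact ((ENNReal.ofReal_lt_ofReal_iff'.1 hq1).1).le
    simp only [R, share_eq_zero_of_not_active hf hδ hS this, mul_zero, ENNReal.ofReal_zero]
  have hmeas : MeasurableSet (⋃ q : ι, Set.Ioc (I.release j) (q.1 : ℝ)) :=
    MeasurableSet.iUnion fun _ => measurableSet_Ioc
  have h1 : ∫⁻ u in Set.Ioi (I.release j), R u ≤
      ∫⁻ u in ⋃ q : ι, Set.Ioc (I.release j) (q.1 : ℝ), R u := by
    rw [← lintegral_indicator measurableSet_Ioi, ← lintegral_indicator hmeas]
    refine lintegral_mono fun u => ?_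
    by_cases hu : u ∈ Set.Ioi (I.release j)
    · by_cases hu' : u ∈ ⋃ q : ι, Set.Ioc (I.release j) (q.1 : ℝ)
      · simp only [Set.indicator_of_mem hu, Set.indicator_of_mem hu', le_refl]
      · simp only [Set.indicator_of_mem hu, hsub u hu hu', zero_le]
    · simp only [Set.indicator_of_notMem hu, zero_le]
  refine h1.trans ?_
  rw [setLIntegral_iUnion_of_directed]
  · refine iSup_le fun q => ?_
    rcases le_total (I.release j) (q.1 : ℝ) with h | h
    · exact (processed_lt_of_lt_completionTime h q.2).le
    · rw [Set.Ioc_eq_empty (not_lt.2 h)]; simp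
  · intro q q'
    rcases le_total q.1 q'.1 with h | h
    · exact ⟨q', Set.Ioc_subset_Ioc_right (by exact_mod_cast h), le_rfl⟩
    · exact ⟨q, le_rfl, Set.Ioc_subset_Ioc_right (by exact_mod_cast h)⟩

/-- The part of the dual variable accumulated after time `t`. -/
theorem rate_mul_lintegral_dualRate_le (hf : ∀ i, IsPowerFunction (f i)) (hδ : 0 ≤ δ)
    (haug : 0 < aug) (hS : IsRun aug (selfishMigrateEnergy f k δ) I S) {j : ℕ} (hj : j ∈ I.jobs)
    (i : Fin m) {t T : ℝ} (ht : I.release j ≤ t) :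
    ENNReal.ofReal (I.rate i j) *
      ∫⁻ u in Set.Ioc t T, ENNReal.ofReal (dualRate f k I (runQueues f δ aug I S u) j) ≤
    ENNReal.ofReal ((1 + δ) / ((k + 1) * aug) * I.size j *
      ((if t ≤ T then listWeight I (runQueues f δ aug I S t i) else 0) /
        powerInv (f i) (if t ≤ T then listWeight I (runQueues f δ aug I S t i) else 0) +
        I.weight j / powerInv (f i) (I.weight j))) := by
  by_cases hT : t ≤ T
  swap
  · rw [Set.Ioc_eq_empty (fun h => hT h.le)]; simp
  simp only [hT, if_true]
  set x := listWeight I (runQueues f δ aug I S t i)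
  have hinv := fun u => runQueues_invariant (aug := aug) (I := I) (S := S) hf hδ u
  have hx : 0 ≤ x := listWeight_nonneg fun a ha => (hinv t).valid.mem_jobs ha
  have hw := I.weight_pos j hj
  set Λ := x / powerInv (f i) x + I.weight j / powerInv (f i) (I.weight j)
  have hΛ : 0 ≤ Λ := by
    have := (hf i).powerInv_nonneg hx
    have := (hf i).powerInv_nonneg hw.le
    positivity
  have hc : 0 ≤ (1 + δ) / ((k + 1) * aug) * Λ := by positivity
  have hpt : ∀ u ∈ Set.Ioc t T, ENNReal.ofReal (I.rate i j) *
      ENNReal.ofReal (dualRate f k I (runQueues f δ aug I S u) j) ≤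
      ENNReal.ofReal ((1 + δ) / ((k + 1) * aug) * Λ) *
        ENNReal.ofReal (aug * I.rate ((S u).machine j) j * (S u).share j) := by
    intro u hu
    by_cases hact : IsActive aug I S j u
    · have hq := (queued_runQueues_iff (f := f) hf hδ).2 hact
      have hact' : IsActive aug I S j t := activeAt_of_le hu.1.le hact ht
      have hq' := (queued_runQueues_iff (f := f) hf hδ).2 hact'
      -- Equilibrium at the earlier time `t` is combined with growth of the utility from `t` to `u`.
      -- On its own machine the job compares with the weight `x` of the whole queue, which is at
      -- least the weight ahead of it.
      have hutil : utility f I i j x ≤ (1 + δ) * jobUtility f I (runQueues f δ aug I S u) j := by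
        have hmono := (improvesFor_queueAt hf hδ hu.1.le ht hact).1
        refine le_trans ?_ (mul_le_mul_of_nonneg_left hmono (by linarith))
        change _ ≤ (1 + δ) * jobUtility f I (runQueues f δ aug I S t) j
        obtain ⟨d, hd⟩ := hq'
        have h0 := jobUtility_nonneg hf (hinv t).valid ⟨d, hd⟩
        rw [jobUtility_eq (hinv t).valid hd] at h0 ⊢
        by_cases hid : i = d
        · subst hid
          have hmem : ∀ a ∈ runQueues f δ aug I S t i, a ∈ I.jobs :=
            fun a ha => (hinv t).valid.mem_jobs ha
          have := utility_anti hf i hj (aheadWeight_nonneg hmem j)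
            (show aheadWeight I (runQueues f δ aug I S t i) j ≤ x by
              have := aheadWeight_add_le hmem hd
              linarith)
          nlinarith
        · exact (hinv t).equilibrium d j hd i hid
      have := rate_mul_dualRate_le (k := k) hf hδ (hinv u).valid hq i hx hutil
      change _ ≤ (1 + δ) / (k + 1) * Λ * _ at this
      rw [← ENNReal.ofReal_mul (I.rate_nonneg i j hj), ← ENNReal.ofReal_mul hc]
      refine ENNReal.ofReal_le_ofReal (this.trans (le_of_eq ?_))
      rw [isRun_eq hf hδ hS u]
      change _ = (1 + δ) / ((k + 1) * aug) * Λ * (aug *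
        I.rate ((decisionOf f k I.weight (runQueues f δ aug I S u)).machine j) j *
        (decisionOf f k I.weight (runQueues f δ aug I S u)).share j)
      field_simp
    · rw [dualRate_of_not_queued (mt (queued_runQueues_iff hf hδ).1 hact)]
      simp
  calc _ ≤ ∫⁻ u in Set.Ioc t T, ENNReal.ofReal (I.rate i j) *
        ENNReal.ofReal (dualRate f k I (runQueues f δ aug I S u) j) := lintegral_const_mul_le _ _
    _ ≤ ∫⁻ u in Set.Ioc t T, ENNReal.ofReal ((1 + δ) / ((k + 1) * aug) * Λ) *
        ENNReal.ofReal (aug * I.rate ((S u).machine j) j * (S u).share j) :=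
      setLIntegral_mono' measurableSet_Ioc hpt
    _ = ENNReal.ofReal ((1 + δ) / ((k + 1) * aug) * Λ) * ∫⁻ u in Set.Ioc t T,
        ENNReal.ofReal (aug * I.rate ((S u).machine j) j * (S u).share j) :=
      lintegral_const_mul' _ _ ENNReal.ofReal_ne_top
    _ ≤ ENNReal.ofReal ((1 + δ) / ((k + 1) * aug) * Λ) * ENNReal.ofReal (I.size j) := by
      gcongr
      refine le_trans (lintegral_mono_set ?_) (lintegral_rate_le_size hf hδ hS j)
      exact fun u hu => ht.trans_lt hu.1
    _ = _ := by
      rw [← ENNReal.ofReal_mul hc]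
      congr 1
      ring

/-- The part of the dual variable accumulated until time `t`. -/
theorem lintegral_dualRate_le (hf : ∀ i, IsPowerFunction (f i)) (hδ : 0 ≤ δ) {j : ℕ} (t : ℝ) :
    ∫⁻ u in Set.Ioc 0 t, ENNReal.ofReal (dualRate f k I (runQueues f δ aug I S u) j) ≤
      ENNReal.ofReal (I.weight j) * ENNReal.ofReal (t - I.release j) := by
  calc _ ≤ ∫⁻ u in Set.Ioc 0 t, (Set.Ici (I.release j)).indicator
        (fun _ => ENNReal.ofReal (I.weight j)) u := by
        refine lintegral_mono fun u => ?_
        by_cases hact : IsActive aug I S j u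
        · rw [Set.indicator_of_mem (Set.mem_Ici.2 hact.2.1)]
          exact ENNReal.ofReal_le_ofReal (dualRate_le_weight hf (runQueues_invariant hf hδ u).valid
            ((queued_runQueues_iff hf hδ).2 hact))
        · dsimp only
          rw [dualRate_of_not_queued (mt (queued_runQueues_iff hf hδ).1 hact)]
          simp
    _ ≤ ENNReal.ofReal (I.weight j) * (volume.restrict (Set.Ioc 0 t)) (Set.Ici (I.release j)) :=
      lintegral_indicator_const_le _ _
    _ ≤ ENNReal.ofReal (I.weight j) * volume (Set.Icc (I.release j) t) := by
      rw [Measure.restrict_apply measurableSet_Ici]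
      gcongr
      exact fun u hu => ⟨hu.1, hu.2.2⟩
    _ = _ := by rw [Real.volume_Icc]

theorem weightUntil_le (hf : ∀ i, IsPowerFunction (f i)) (hδ : 0 ≤ δ) (T : ℝ) :
    weightUntil f δ aug I S T ≤ (k + 2) * ∑ j ∈ I.jobs, ∫⁻ u in Set.Ioc 0 T,
      ENNReal.ofReal (dualRate f k I (runQueues f δ aug I S u) j) := by
  rw [← lintegral_finsetSum _ fun j _ =>
    measurable_runQueues fun Q => ENNReal.ofReal (dualRate f k I Q j),
    ← lintegral_const_mul' _ _ (by finiteness)]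
  refine lintegral_mono fun u => ?_
  have hQ := (runQueues_invariant (aug := aug) (I := I) (S := S) hf hδ u).valid
  refine (ENNReal.ofReal_le_ofReal (totalWeight_le_sum_dualRate (k := k) hf hQ)).trans ?_
  rw [ENNReal.ofReal_mul (by positivity), ENNReal.ofReal_sum_of_nonneg fun j _ =>
    dualRate_nonneg hf hQ j]
  gcongr
  rw [ENNReal.ofReal_add (by positivity) (by positivity)]
  simp

/-- The cost of the algorithm is twice its weighted flow-time. -/
theorem cost_le (hf : ∀ i, IsPowerFunction (f i)) (hδ : 0 ≤ δ)
    (hS : IsRun aug (selfishMigrateEnergy f k δ) I S) :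
    cost aug I S f ≤
      2 * ∫⁻ u in Set.Ioi 0, ENNReal.ofReal (totalWeight I (runQueues f δ aug I S u)) := by
  classical
  rw [two_mul, cost]
  refine add_le_add ?_ ?_
  · have hpt : ∀ u, ENNReal.ofReal (totalWeight I (runQueues f δ aug I S u)) =
        ∑ j ∈ I.jobs, if IsActive aug I S j u then ENNReal.ofReal (I.weight j) else 0 := by
      intro u
      rw [totalWeight_eq_sum (runQueues_invariant hf hδ u).valid, ENNReal.ofReal_sum_of_nonneg]
      · refine Finset.sum_congr rfl fun j hj => ?_
        simp only [queued_runQueues_iff hf hδ]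
        split_ifs <;> simp
      · intro j hj
        split_ifs
        exacts [(I.weight_pos j hj).le, le_rfl]
    simp only [hpt]
    refine le_trans (Finset.sum_le_sum fun j hj => ?_) (sum_lintegral_le _ _ _)
    have hr := I.release_nonneg j hj
    have key : ∀ A : Set ℝ, MeasurableSet A → A ⊆ Set.Ioi 0 → (∀ u ∈ A, IsActive aug I S j u) →
        ENNReal.ofReal (I.weight j) * volume A ≤
        ∫⁻ u in Set.Ioi 0, if IsActive aug I S j u then ENNReal.ofReal (I.weight j) else 0 := by
      intro A hA hA0 hact
      rw [← setLIntegral_const]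
      refine le_trans (setLIntegral_mono' hA fun u hu => ?_) (lintegral_mono_set hA0)
      rw [if_pos (hact u hu)]
    by_cases hC : completionTime aug I S j = ∞
    · refine le_trans ?_ (key (Set.Ioi (I.release j)) measurableSet_Ioi
        (Set.Ioi_subset_Ioi hr) fun u hu => ⟨hj, le_of_lt hu, ?_⟩)
      · rw [Real.volume_Ioi]
        gcongr
        exact le_top
      · rw [hC]; exact ENNReal.ofReal_lt_top
    · refine le_trans ?_ (key (Set.Ioo (I.release j) (completionTime aug I S j).toReal)
        measurableSet_Ioo (fun u hu => hr.trans_lt hu.1) fun u hu => ⟨hj, hu.1.le, ?_⟩)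
      · rw [Real.volume_Ioo, ENNReal.ofReal_sub _ hr, ENNReal.ofReal_toReal hC, flowTime]
      · exact (ENNReal.ofReal_lt_iff_lt_toReal (hr.trans hu.1.le) hC).2 hu.2
  · have hsp : ∀ t i, f i ((S t).speed i) = listWeight I (runQueues f δ aug I S t i) := fun t i =>
      ((isSelfishMigrateEnergy_of_isRun hf hδ hS).power_eq t i).2
    simp only [hsp]
    rw [← lintegral_finsetSum _ fun i _ =>
      measurable_runQueues fun Q => ENNReal.ofReal (listWeight I (Q i)),
      setLIntegral_congr Ioi_ae_eq_Ici.symm]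
    refine lintegral_mono fun u => ?_
    rw [totalWeight, ENNReal.ofReal_sum_of_nonneg]
    exact fun i _ => listWeight_nonneg fun a ha => (runQueues_invariant hf hδ u).valid.mem_jobs ha

end Algorithm

end

/-! ### Comparison with an arbitrary feasible schedule. -/

section Competitive

variable {m : ℕ} {f : Fin m → ℝ → ℝ} {k : ℕ} {δ aug : ℝ} {I : JobInstance m}
  {S O : Schedule m}

/-- The weight of queue `i` at time `t`, cut off at time `T`. -/
def cutWeight (f : Fin m → ℝ → ℝ) (δ aug : ℝ) (I : JobInstance m) (S : Schedule m) (T : ℝ)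
    (i : Fin m) (t : ℝ) : ℝ :=
  if t ≤ T then listWeight I (runQueues f δ aug I S t i) else 0

/-- The price per unit of speed that job `j` pays on machine `i` at time `t`. -/
def price (f : Fin m → ℝ → ℝ) (δ aug : ℝ) (I : JobInstance m) (S : Schedule m) (T : ℝ) (j : ℕ)
    (i : Fin m) (t : ℝ) : ℝ :=
  cutWeight f δ aug I S T i t / powerInv (f i) (cutWeight f δ aug I S T i t) +
    I.weight j / powerInv (f i) (I.weight j)

variable [Nonempty (Fin m)]

theorem cutWeight_nonneg (hf : ∀ i, IsPowerFunction (f i)) (hδ : 0 ≤ δ) (T : ℝ) (i : Fin m)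
    (t : ℝ) : 0 ≤ cutWeight f δ aug I S T i t := by
  unfold cutWeight
  split_ifs
  · exact listWeight_nonneg fun a ha => (runQueues_invariant hf hδ t).valid.mem_jobs ha
  · exact le_rfl

theorem price_nonneg (hf : ∀ i, IsPowerFunction (f i)) (hδ : 0 ≤ δ) (T : ℝ) {j : ℕ}
    (hj : j ∈ I.jobs) (i : Fin m) (t : ℝ) : 0 ≤ price f δ aug I S T j i t := by
  have h1 := cutWeight_nonneg (aug := aug) (I := I) (S := S) hf hδ T i t
  have h2 := (hf i).powerInv_nonneg h1
  have h3 := (I.weight_pos j hj).le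
  have h4 := (hf i).powerInv_nonneg h3
  unfold price
  positivity

/-- The dual variable of a job is bounded by its flow-time and the prices it pays in a schedule
that completes it by time `D`. -/
theorem dual_le (hf : ∀ i, IsPowerFunction (f i)) (hδ : 0 ≤ δ) (haug : 0 < aug)
    (hS : IsRun aug (selfishMigrateEnergy f k δ) I S) (hO : IsFeasible I O) {j : ℕ}
    (hj : j ∈ I.jobs) {D : ℝ} (hD : ENNReal.ofReal (I.size j) ≤ processed 1 I O j D) (T : ℝ) :
    ∫⁻ u in Set.Ioc 0 T, ENNReal.ofReal (dualRate f k I (runQueues f δ aug I S u) j) ≤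
      ENNReal.ofReal (I.weight j) * ENNReal.ofReal (D - I.release j) +
      ENNReal.ofReal ((1 + δ) / ((k + 1) * aug)) * ∫⁻ t in Set.Ioc (I.release j) D,
        ENNReal.ofReal (price f δ aug I S T j ((O t).machine j) t * (O t).share j) := by
  set a := ∫⁻ u in Set.Ioc 0 T, ENNReal.ofReal (dualRate f k I (runQueues f δ aug I S u) j)
  set θ := (1 + δ) / ((k + 1) * aug)
  have hθ : 0 ≤ θ := by positivity
  -- Until any `t ≤ D` the job accumulates at most its weight times `D - r`, so the excess `b` must
  -- accumulate after `t`. This bounds `b` at every `t` at once.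
  set b := a - ENNReal.ofReal (I.weight j) * ENNReal.ofReal (D - I.release j)
  have hp := I.size_pos j hj
  suffices H : b ≤ ENNReal.ofReal θ * ∫⁻ t in Set.Ioc (I.release j) D,
        ENNReal.ofReal (price f δ aug I S T j ((O t).machine j) t * (O t).share j) by
    exact le_add_tsub.trans (add_le_add le_rfl H)
  have hpt : ∀ t ∈ Set.Ioc (I.release j) D,
      ENNReal.ofReal (1 * I.rate ((O t).machine j) j * (O t).share j) * b ≤
      ENNReal.ofReal (θ * I.size j) *
        ENNReal.ofReal (price f δ aug I S T j ((O t).machine j) t * (O t).share j) := by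
    intro t ht
    have hb : b ≤ ∫⁻ u in Set.Ioc t T,
        ENNReal.ofReal (dualRate f k I (runQueues f δ aug I S u) j) := by
      rw [tsub_le_iff_left]
      calc a ≤ ∫⁻ u in Set.Ioc 0 t ∪ Set.Ioc t T,
            ENNReal.ofReal (dualRate f k I (runQueues f δ aug I S u) j) := by
            refine lintegral_mono_set fun u hu => ?_
            rcases le_or_gt u t with h | h
            · exact Or.inl ⟨hu.1, h⟩
            · exact Or.inr ⟨h, hu.2⟩
        _ ≤ _ := (lintegral_union_le _ _ _).trans (add_le_add
            ((lintegral_dualRate_le hf hδ t).trans (by gcongr; exact ht.2)) le_rfl)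
    have hnu := hO.share_nonneg j hj t
    have hr := I.rate_nonneg ((O t).machine j) j hj
    have hprice := price_nonneg (aug := aug) (S := S) hf hδ T hj ((O t).machine j) t
    have h1 := rate_mul_lintegral_dualRate_le hf hδ haug hS hj ((O t).machine j) (T := T) ht.1.le
    calc ENNReal.ofReal (1 * I.rate ((O t).machine j) j * (O t).share j) * b
        = ENNReal.ofReal ((O t).share j) * (ENNReal.ofReal (I.rate ((O t).machine j) j) * b) := by
          rw [one_mul, ENNReal.ofReal_mul hr]; ring
      _ ≤ ENNReal.ofReal ((O t).share j) * (ENNReal.ofReal (I.rate ((O t).machine j) j) *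
          ∫⁻ u in Set.Ioc t T, ENNReal.ofReal (dualRate f k I (runQueues f δ aug I S u) j)) := by
        gcongr
      _ ≤ ENNReal.ofReal ((O t).share j) *
          ENNReal.ofReal (θ * I.size j * price f δ aug I S T j ((O t).machine j) t) := by
        gcongr
        exact h1
      _ = _ := by
        rw [← ENNReal.ofReal_mul hnu, ← ENNReal.ofReal_mul (by positivity)]
        congr 1
        ring
  -- Integrating against the processing rate of the comparison schedule, whose total is at least the
  -- size, averages these bounds; the size then cancels.
  have hint : ENNReal.ofReal (I.size j) * b ≤ ENNReal.ofReal (I.size j) * (ENNReal.ofReal θ *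
      ∫⁻ t in Set.Ioc (I.release j) D,
        ENNReal.ofReal (price f δ aug I S T j ((O t).machine j) t * (O t).share j)) := by
    calc ENNReal.ofReal (I.size j) * b ≤ processed 1 I O j D * b := by gcongr
      _ ≤ ∫⁻ t in Set.Ioc (I.release j) D,
          ENNReal.ofReal (1 * I.rate ((O t).machine j) j * (O t).share j) * b :=
        lintegral_mul_const_le _ _
      _ ≤ ∫⁻ t in Set.Ioc (I.release j) D, ENNReal.ofReal (θ * I.size j) *
          ENNReal.ofReal (price f δ aug I S T j ((O t).machine j) t * (O t).share j) :=
        setLIntegral_mono' measurableSet_Ioc hpt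
      _ = _ := by
        rw [lintegral_const_mul' _ _ ENNReal.ofReal_ne_top, mul_comm θ,
          ENNReal.ofReal_mul hp.le, mul_assoc]
  exact (ENNReal.mul_le_mul_iff_right (ENNReal.ofReal_pos.2 hp).ne' ENNReal.ofReal_ne_top).1 hint

/-- At every time, the total price paid is bounded by the weights and the energy. -/
theorem sum_price_le (hf : ∀ i, IsPowerFunction (f i)) (hδ : 0 ≤ δ) (hO : IsFeasible I O)
    (T t : ℝ) {B : Finset ℕ} (hB : B ⊆ I.jobs) :
    ∑ j ∈ B, price f δ aug I S T j ((O t).machine j) t * (O t).share j ≤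
      ∑ j ∈ B, I.weight j + ∑ i, cutWeight f δ aug I S T i t +
        2 * ∑ i, f i ((O t).speed i) := by
  classical
  set x : Fin m → ℝ := fun i => cutWeight f δ aug I S T i t
  have hx : ∀ i, 0 ≤ x i := fun i => cutWeight_nonneg hf hδ T i t
  have hxg : ∀ i, 0 ≤ x i / powerInv (f i) (x i) := fun i =>
    div_nonneg (hx i) ((hf i).powerInv_nonneg (hx i))
  have h1 : ∀ j ∈ B, price f δ aug I S T j ((O t).machine j) t * (O t).share j ≤
      I.weight j + (x ((O t).machine j) / powerInv (f ((O t).machine j)) (x ((O t).machine j)) *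
        (O t).share j + f ((O t).machine j) ((O t).share j)) := by
    intro j hj
    have := (hf ((O t).machine j)).div_powerInv_mul_le (I.weight_pos j (hB hj)).le
      (hO.share_nonneg j (hB hj) t)
    rw [price, add_mul]
    change x ((O t).machine j) / powerInv (f ((O t).machine j)) (x ((O t).machine j)) * _ + _ ≤ _
    linarith
  have h2 : ∑ j ∈ B, (x ((O t).machine j) / powerInv (f ((O t).machine j)) (x ((O t).machine j)) *
        (O t).share j + f ((O t).machine j) ((O t).share j)) ≤
      ∑ i, (x i + 2 * f i ((O t).speed i)) := by
    refine (Finset.sum_le_sum_of_subset_of_nonneg hB fun j hj _ => ?_).trans ?_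
    · have := hO.share_nonneg j hj t
      exact add_nonneg (mul_nonneg (hxg _) this) ((hf _).nonneg _ this)
    rw [← Finset.sum_fiberwise I.jobs (fun j => (O t).machine j)]
    refine Finset.sum_le_sum fun i _ => ?_
    have h3 : ∀ j ∈ I.jobs.filter (fun j => (O t).machine j = i), 0 ≤ (O t).share j :=
      fun j hj => hO.share_nonneg j (Finset.mem_filter.1 hj).1 t
    have h4 := hO.sum_share_le i t
    rw [Finset.sum_congr rfl (g := fun j => x i / powerInv (f i) (x i) * (O t).share j +
      f i ((O t).share j)) fun j hj => by rw [(Finset.mem_filter.1 hj).2], Finset.sum_add_distrib,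
      ← Finset.mul_sum]
    -- One copy of the energy pays for the own-weight terms through superadditivity, the second for
    -- the queue terms through the Young inequality.
    have h5 := (hf i).sum_le _ h3 h4
    have h6 := (hf i).div_powerInv_mul_le (hx i) (hO.speed_nonneg i t)
    have h7 := mul_le_mul_of_nonneg_left h4 (hxg i)
    linarith
  refine (Finset.sum_le_sum h1).trans ?_
  rw [Finset.sum_add_distrib]
  have h3 : ∑ i, (x i + 2 * f i ((O t).speed i)) = ∑ i, x i + 2 * ∑ i, f i ((O t).speed i) := by
    rw [Finset.sum_add_distrib, Finset.mul_sum]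
  linarith

theorem sum_lintegral_price_le (hf : ∀ i, IsPowerFunction (f i)) (hδ : 0 ≤ δ)
    (hO : IsFeasible I O) (T : ℝ) (D : ℕ → ℝ) :
    ∑ j ∈ I.jobs, ∫⁻ t in Set.Ioc (I.release j) (D j),
        ENNReal.ofReal (price f δ aug I S T j ((O t).machine j) t * (O t).share j) ≤
      ∑ j ∈ I.jobs, ENNReal.ofReal (I.weight j) * ENNReal.ofReal (D j - I.release j) +
        weightUntil f δ aug I S T +
        2 * ∑ i, ∫⁻ t in Set.Ici (0 : ℝ), ENNReal.ofReal (f i ((O t).speed i)) := by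
  classical
  have hfs : ∀ i t, 0 ≤ f i ((O t).speed i) := fun i t => (hf i).nonneg _ (hO.speed_nonneg i t)
  set H : ℕ → ℝ → ℝ := fun j t => price f δ aug I S T j ((O t).machine j) t * (O t).share j
  have hH : ∀ j ∈ I.jobs, ∀ t, 0 ≤ H j t := fun j hj t =>
    mul_nonneg (price_nonneg hf hδ T hj _ t) (hO.share_nonneg j hj t)
  have hpt : ∀ t ∈ Set.Ioi (0 : ℝ), ∑ j ∈ I.jobs, (Set.Ioc (I.release j) (D j)).indicator
      (fun t => ENNReal.ofReal (H j t)) t ≤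
      ∑ j ∈ I.jobs, (Set.Ioc (I.release j) (D j)).indicator
        (fun _ => ENNReal.ofReal (I.weight j)) t +
      ((Set.Ioc 0 T).indicator
        (fun t => ENNReal.ofReal (totalWeight I (runQueues f δ aug I S t))) t +
        2 * ∑ i, ENNReal.ofReal (f i ((O t).speed i))) := by
    intro t ht
    -- Only jobs still inside their comparison interval pay at time `t`.
    set B := I.jobs.filter fun j => t ∈ Set.Ioc (I.release j) (D j)
    have hB : B ⊆ I.jobs := Finset.filter_subset _ _
    have e1 : ∀ φ : ℕ → ℝ → ℝ, (∀ j ∈ I.jobs, 0 ≤ φ j t) →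
        ∑ j ∈ I.jobs, (Set.Ioc (I.release j) (D j)).indicator (fun t => ENNReal.ofReal (φ j t)) t =
        ENNReal.ofReal (∑ j ∈ B, φ j t) := by
      intro φ hφ
      rw [ENNReal.ofReal_sum_of_nonneg fun j hj => hφ j (hB hj), Finset.sum_filter]
      exact Finset.sum_congr rfl fun j _ => by rw [Set.indicator_apply]
    have e2 : (Set.Ioc 0 T).indicator
        (fun t => ENNReal.ofReal (totalWeight I (runQueues f δ aug I S t))) t =
        ENNReal.ofReal (∑ i, cutWeight f δ aug I S T i t) := by
      rw [Set.indicator_apply]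
      by_cases h : t ≤ T
      · rw [if_pos ⟨ht, h⟩]
        simp only [cutWeight, h, if_true, totalWeight]
      · rw [if_neg fun h' => h h'.2]
        simp only [cutWeight, h, if_false, Finset.sum_const_zero, ENNReal.ofReal_zero]
    rw [e1 H fun j hj => hH j hj t, e1 (fun j _ => I.weight j) fun j hj => (I.weight_pos j hj).le,
      e2, ← ENNReal.ofReal_sum_of_nonneg fun i _ => hfs i t,
      show (2 : ℝ≥0∞) = ENNReal.ofReal 2 by simp, ← ENNReal.ofReal_mul zero_le_two,
      ← ENNReal.ofReal_add, ← ENNReal.ofReal_add]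
    · refine ENNReal.ofReal_le_ofReal ((sum_price_le hf hδ hO T t hB).trans (le_of_eq ?_))
      ring
    · exact Finset.sum_nonneg fun j hj => (I.weight_pos j (hB hj)).le
    · exact add_nonneg (Finset.sum_nonneg fun i _ => cutWeight_nonneg hf hδ T i t)
        (mul_nonneg zero_le_two (Finset.sum_nonneg fun i _ => hfs i t))
    · exact Finset.sum_nonneg fun i _ => cutWeight_nonneg hf hδ T i t
    · exact mul_nonneg zero_le_two (Finset.sum_nonneg fun i _ => hfs i t)
  have hsub : ∀ j ∈ I.jobs, Set.Ioc (I.release j) (D j) ⊆ Set.Ioi 0 := fun j hj t ht =>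
    (I.release_nonneg j hj).trans_lt ht.1
  have hrestr : ∀ (j : ℕ), j ∈ I.jobs → ∀ φ : ℝ → ℝ≥0∞,
      ∫⁻ t in Set.Ioi 0, (Set.Ioc (I.release j) (D j)).indicator φ t =
      ∫⁻ t in Set.Ioc (I.release j) (D j), φ t := by
    intro j hj φ
    rw [setLIntegral_indicator measurableSet_Ioc, Set.inter_eq_left.2 (hsub j hj)]
  have hmW : Measurable fun t => ENNReal.ofReal (totalWeight I (runQueues f δ aug I S t)) :=
    measurable_runQueues fun Q => ENNReal.ofReal (totalWeight I Q)
  calc ∑ j ∈ I.jobs, ∫⁻ t in Set.Ioc (I.release j) (D j), ENNReal.ofReal (H j t)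
      = ∑ j ∈ I.jobs, ∫⁻ t in Set.Ioi 0, (Set.Ioc (I.release j) (D j)).indicator
          (fun t => ENNReal.ofReal (H j t)) t :=
        Finset.sum_congr rfl fun j hj => (hrestr j hj _).symm
    _ ≤ ∫⁻ t in Set.Ioi 0, ∑ j ∈ I.jobs, (Set.Ioc (I.release j) (D j)).indicator
          (fun t => ENNReal.ofReal (H j t)) t := sum_lintegral_le _ _ _
    _ ≤ _ := setLIntegral_mono' measurableSet_Ioi hpt
    _ = ∑ j ∈ I.jobs, ENNReal.ofReal (I.weight j) * ENNReal.ofReal (D j - I.release j) +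
        (weightUntil f δ aug I S T +
        2 * ∑ i, ∫⁻ t in Set.Ioi (0 : ℝ), ENNReal.ofReal (f i ((O t).speed i))) := by
      rw [lintegral_add_left (Finset.measurable_sum _ fun j _ =>
          measurable_const.indicator measurableSet_Ioc),
        lintegral_add_left (hmW.indicator measurableSet_Ioc),
        lintegral_finsetSum _ fun j _ => measurable_const.indicator measurableSet_Ioc,
        lintegral_const_mul' _ _ (by simp), lintegral_finsetSum _ fun i _ =>
          ((hf i).measurable_comp (hO.measurable_speed i) (hO.speed_nonneg i)).ennreal_ofReal,
        setLIntegral_indicator measurableSet_Ioc, Set.inter_eq_left.2 Set.Ioc_subset_Ioi_self,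
        weightUntil]
      congr 1
      refine Finset.sum_congr rfl fun j hj => ?_
      rw [hrestr j hj, setLIntegral_const, Real.volume_Ioc]
    _ ≤ _ := by
      rw [add_assoc]
      gcongr
      exact Set.Ioi_subset_Ici_self

theorem weightUntil_le_of_completed (hf : ∀ i, IsPowerFunction (f i)) (hδ : 0 ≤ δ)
    (haug : 0 < aug) (hθ : (1 + δ) / ((k + 1) * aug) ≤ 1 / (k + 3))
    (hS : IsRun aug (selfishMigrateEnergy f k δ) I S) (hO : IsFeasible I O) {D : ℕ → ℝ}
    (hD : ∀ j ∈ I.jobs, ENNReal.ofReal (I.size j) ≤ processed 1 I O j (D j)) (T : ℝ) :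
    weightUntil f δ aug I S T ≤ ENNReal.ofReal (2 * ((k + 2) * (k + 3))) *
      (∑ j ∈ I.jobs, ENNReal.ofReal (I.weight j) * ENNReal.ofReal (D j - I.release j) +
        ∑ i, ∫⁻ t in Set.Ici (0 : ℝ), ENNReal.ofReal (f i ((O t).speed i))) := by
  set X := weightUntil f δ aug I S T
  set F := ∑ j ∈ I.jobs, ENNReal.ofReal (I.weight j) * ENNReal.ofReal (D j - I.release j)
  set E := ∑ i, ∫⁻ t in Set.Ici (0 : ℝ), ENNReal.ofReal (f i ((O t).speed i))
  -- The self-bounding inequality: the coefficient of `X` on the right is `(k + 2) / (k + 3)`.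
  -- Truncation at `T` makes `X` finite, so it can be absorbed.
  have h1 : X ≤ (k + 2) * (F + ENNReal.ofReal (1 / (k + 3)) * (F + X + 2 * E)) := by
    refine (weightUntil_le (k := k) hf hδ T).trans ?_
    gcongr
    refine (Finset.sum_le_sum fun j hj => dual_le hf hδ haug hS hO hj (hD j hj) T).trans ?_
    rw [Finset.sum_add_distrib, ← Finset.mul_sum]
    gcongr
    exact sum_lintegral_price_le hf hδ hO T D
  have hX : X ≠ ∞ := (weightUntil_lt_top T).ne
  by_cases hE : E = ∞
  · rw [hE, add_top, ENNReal.mul_top]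
    · exact le_top
    · exact (ENNReal.ofReal_pos.2 (by positivity)).ne'
  have hF : F ≠ ∞ := by
    refine (ENNReal.sum_lt_top.2 fun j _ => ?_).ne
    exact ENNReal.mul_lt_top ENNReal.ofReal_lt_top ENNReal.ofReal_lt_top
  rw [← ENNReal.ofReal_toReal hX, ← ENNReal.ofReal_toReal hE, ← ENNReal.ofReal_toReal hF] at h1 ⊢
  have hx0 : 0 ≤ X.toReal := ENNReal.toReal_nonneg
  have he0 : 0 ≤ E.toReal := ENNReal.toReal_nonneg
  have hf0 : 0 ≤ F.toReal := ENNReal.toReal_nonneg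
  have hk2 : ((k : ℝ≥0∞) + 2) = ENNReal.ofReal ((k : ℝ) + 2) := by
    rw [ENNReal.ofReal_add (by positivity) (by positivity)]; simp
  rw [hk2, show (2 : ℝ≥0∞) = ENNReal.ofReal 2 by simp, ← ENNReal.ofReal_mul (by positivity),
    ← ENNReal.ofReal_add (by positivity) (by positivity),
    ← ENNReal.ofReal_add (by positivity) (by positivity),
    ← ENNReal.ofReal_mul (by positivity), ← ENNReal.ofReal_add (by positivity) (by positivity),
    ← ENNReal.ofReal_mul (by positivity), ENNReal.ofReal_le_ofReal_iff (by positivity)] at h1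
  rw [← ENNReal.ofReal_add (by positivity) (by positivity), ← ENNReal.ofReal_mul (by positivity)]
  refine ENNReal.ofReal_le_ofReal ?_
  have hk : (0 : ℝ) ≤ k := by positivity
  set x := X.toReal
  set e := E.toReal
  set φ := F.toReal
  have h2 : (k + 3 : ℝ) * x ≤ (k + 2) * ((k + 3) * φ + (φ + x + 2 * e)) := by
    have := mul_le_mul_of_nonneg_left h1 (show (0 : ℝ) ≤ k + 3 by positivity)
    refine this.trans (le_of_eq ?_)
    field_simp
  have h3 : 0 ≤ (k + 2) * (k + 2) * φ := by positivity
  have h4 : 0 ≤ (k + 2) * (k + 2) * e := by positivity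
  nlinarith

theorem weightUntil_le_cost (hf : ∀ i, IsPowerFunction (f i)) (hδ : 0 ≤ δ)
    (haug : 0 < aug) (hθ : (1 + δ) / ((k + 1) * aug) ≤ 1 / (k + 3))
    (hS : IsRun aug (selfishMigrateEnergy f k δ) I S) (hO : IsFeasible I O) (T : ℝ) :
    weightUntil f δ aug I S T ≤ ENNReal.ofReal (2 * ((k + 2) * (k + 3))) * cost 1 I O f := by
  set K : ℝ := 2 * ((k + 2) * (k + 3))
  have hK : 0 < K := by positivity
  by_cases hC : ∃ j ∈ I.jobs, completionTime 1 I O j = ∞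
  · obtain ⟨j, hj, hjC⟩ := hC
    have : cost 1 I O f = ∞ := by
      rw [cost, ENNReal.add_eq_top, ENNReal.sum_eq_top]
      refine Or.inl ⟨j, hj, ?_⟩
      rw [flowTime, hjC, ENNReal.top_sub ENNReal.ofReal_ne_top, ENNReal.mul_top]
      exact (ENNReal.ofReal_pos.2 (I.weight_pos j hj)).ne'
    rw [this, ENNReal.mul_top (ENNReal.ofReal_pos.2 hK).ne']
    exact le_top
  push Not at hC
  have hw0 : 0 ≤ ∑ j ∈ I.jobs, I.weight j :=
    Finset.sum_nonneg fun j hj => (I.weight_pos j hj).le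
  refine ENNReal.le_of_forall_pos_le_add fun r hr _ => ?_
  -- A completion time of an arbitrary schedule is an infimum that need not be attained, as its
  -- speeds may be unbounded. Each job gets extra time `η`, which costs at most `r` after
  -- multiplication by `K` and the total weight.
  set η : ℝ := r / (K * (∑ j ∈ I.jobs, I.weight j + 1))
  have hη : 0 < η := by
    have : (0 : ℝ) < r := by exact_mod_cast hr
    positivity
  have hex : ∀ j, ∃ d : ℝ, j ∈ I.jobs → ENNReal.ofReal (I.size j) ≤ processed 1 I O j d ∧
      ENNReal.ofReal (d - I.release j) ≤ flowTime 1 I O j + ENNReal.ofReal η := by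
    intro j
    by_cases hj : j ∈ I.jobs
    · obtain ⟨d, h1, h2, h3⟩ := exists_lt_of_completionTime_lt
        (ENNReal.lt_add_right (hC j hj) (ENNReal.ofReal_pos.2 hη).ne')
      refine ⟨d, fun _ => ⟨h2, ?_⟩⟩
      rw [ENNReal.ofReal_sub _ (I.release_nonneg j hj), flowTime, tsub_le_iff_right]
      refine h3.le.trans ?_
      rw [add_right_comm]
      gcongr
      exact le_tsub_add
    · exact ⟨0, fun h => absurd h hj⟩
  choose D hD using hex
  refine (weightUntil_le_of_completed hf hδ haug hθ hS hO (fun j hj => (hD j hj).1) T).trans ?_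
  have h1 : ∑ j ∈ I.jobs, ENNReal.ofReal (I.weight j) * ENNReal.ofReal (D j - I.release j) ≤
      ∑ j ∈ I.jobs, ENNReal.ofReal (I.weight j) * flowTime 1 I O j +
        ENNReal.ofReal ((∑ j ∈ I.jobs, I.weight j) * η) := by
    rw [ENNReal.ofReal_mul hw0, ENNReal.ofReal_sum_of_nonneg fun j hj => (I.weight_pos j hj).le,
      Finset.sum_mul, ← Finset.sum_add_distrib]
    refine Finset.sum_le_sum fun j hj => ?_
    rw [← mul_add]
    gcongr
    exact (hD j hj).2
  calc _ ≤ ENNReal.ofReal K * (cost 1 I O f + ENNReal.ofReal ((∑ j ∈ I.jobs, I.weight j) * η)) := by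
        refine mul_le_mul_right ?_ _
        rw [cost, add_right_comm]
        exact add_le_add h1 le_rfl
    _ ≤ _ := by
      rw [mul_add]
      gcongr
      rw [← ENNReal.ofReal_mul hK.le, ← ENNReal.ofReal_coe_nnreal]
      refine ENNReal.ofReal_le_ofReal ?_
      have hr0 : (0 : ℝ) ≤ r := r.2
      simp only [η]
      rw [← mul_assoc, mul_div_assoc', div_le_iff₀ (by positivity)]
      nlinarith [mul_nonneg hK.le hr0]

/-- The truncated bounds are uniform in `T`, so monotone convergence removes the truncation. Energy
doubles the constant. -/
theorem cost_le_mul_cost (hf : ∀ i, IsPowerFunction (f i)) (hδ : 0 ≤ δ)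
    (haug : 0 < aug) (hθ : (1 + δ) / ((k + 1) * aug) ≤ 1 / (k + 3))
    (hS : IsRun aug (selfishMigrateEnergy f k δ) I S) (hO : IsFeasible I O) :
    cost aug I S f ≤ ENNReal.ofReal (4 * ((k + 2) * (k + 3))) * cost 1 I O f := by
  refine (cost_le hf hδ hS).trans ?_
  have hun : Set.Ioi (0 : ℝ) = ⋃ n : ℕ, Set.Ioc 0 (n : ℝ) := by
    ext u
    simp only [Set.mem_Ioi, Set.mem_iUnion, Set.mem_Ioc]
    exact ⟨fun h => ⟨⌈u⌉₊, h, Nat.le_ceil u⟩, fun ⟨n, h, _⟩ => h⟩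
  have hle : ∫⁻ u in Set.Ioi 0, ENNReal.ofReal (totalWeight I (runQueues f δ aug I S u)) ≤
      ENNReal.ofReal (2 * ((k + 2) * (k + 3))) * cost 1 I O f := by
    rw [hun, setLIntegral_iUnion_of_directed]
    · exact iSup_le fun n => weightUntil_le_cost hf hδ haug hθ hS hO n
    · exact Monotone.directed_le fun a b hab => Set.Ioc_subset_Ioc_right (by exact_mod_cast hab)
  calc _ ≤ 2 * (ENNReal.ofReal (2 * ((k + 2) * (k + 3))) * cost 1 I O f) := by gcongr
    _ = _ := by
      rw [← mul_assoc, show (2 : ℝ≥0∞) = ENNReal.ofReal 2 by simp,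
        ← ENNReal.ofReal_mul zero_le_two]
      congr 2
      ring

end Competitive

end FlowEnergy

end

/-! ### Choice of the constants. -/

theorem theorem2 :
    ∃ C : ℝ, 0 < C ∧ ∀ ε : ℝ, 0 < ε → ∀ m : ℕ, 0 < m →
      ∀ f : Fin m → ℝ → ℝ, (∀ i, IsPowerFunction (f i)) →
      ∃ A : OnlineAlgorithm m, ∀ I : JobInstance m,
        (∃ S : Schedule m, IsRun (1 + ε) A I S) ∧
        ∀ S : Schedule m, IsRun (1 + ε) A I S →
          IsFeasible I S ∧
          (∃ Q : ℝ → Queues m,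
            IsSelfishMigrateEnergy (1 + ε) f ⌈3 / ε⌉₊ (1 / (⌈3 / ε⌉₊ : ℝ)) I S Q) ∧
          (∀ O : Schedule m, IsFeasible I O →
            cost (1 + ε) I S f ≤ ENNReal.ofReal (C * max 1 (1 / ε ^ 2)) * cost 1 I O f) ∧
          (∀ j ∈ I.jobs, ((migrations (1 + ε) I S j : ℕ∞) : ENNReal) ≤
            ENNReal.ofReal
              (C * max 1 (1 / ε) * (Real.log I.weightRatio + Real.log (I.jobs.card : ℝ)))) := by
  -- With `M = max 1 (1 / ε)` one has `k ≤ 3 * M + 1`, so `4 * (k + 2) * (k + 3) ≤ 4 * (6 * M) * (7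
  -- * M) = 168 * M ^ 2`.
  refine ⟨168, by norm_num, fun ε hε m hm f hf => ?_⟩
  have : Nonempty (Fin m) := ⟨⟨0, hm⟩⟩
  set k := ⌈3 / ε⌉₊
  have hk : 0 < k := Nat.ceil_pos.2 (by positivity)
  have hkR : (0 : ℝ) < k := by exact_mod_cast hk
  have hδ : (0 : ℝ) ≤ 1 / k := by positivity
  set M := max 1 (1 / ε)
  have hM1 : 1 ≤ M := le_max_left _ _
  have hk1 : (k : ℝ) ≤ 3 * M + 1 := by
    refine (Nat.ceil_lt_add_one (by positivity)).le.trans ?_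
    have : 1 / ε ≤ M := le_max_right _ _
    rw [show 3 / ε = 3 * (1 / ε) by ring]
    linarith
  -- After cancelling `k + 1` this says `1 + 3 / k ≤ 1 + ε`, the reason for `k = ⌈3 / ε⌉`.
  have hθ : (1 + 1 / (k : ℝ)) / ((k + 1) * (1 + ε)) ≤ 1 / (k + 3) := by
    have h3 : 3 / ε ≤ k := Nat.le_ceil _
    rw [div_le_iff₀ hε] at h3
    rw [div_le_div_iff₀ (by positivity) (by positivity)]
    have : (1 + 1 / (k : ℝ)) * (k + 3) = (k + 1) * (k + 3) / k := by field_simp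
    rw [this, div_le_iff₀ hkR]
    nlinarith
  refine ⟨selfishMigrateEnergy f k (1 / k), fun I =>
    ⟨exists_isRun_selfishMigrateEnergy hf k hδ _ I, fun S hS =>
      ⟨isFeasible_of_isRun hf hδ hS, ⟨_, isSelfishMigrateEnergy_of_isRun hf hδ hS⟩,
        fun O hO => ?_, fun j hj => ?_⟩⟩⟩
  · refine (cost_le_mul_cost hf hδ (by positivity) hθ hS hO).trans ?_
    gcongr ENNReal.ofReal ?_ * _
    have hM2 : M ^ 2 ≤ max 1 (1 / ε ^ 2) := by
      rcases max_choice 1 (1 / ε) with h | h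
      · simp only [M, h, one_pow]; exact le_max_left _ _
      · simp only [M, h, div_pow, one_pow]; exact le_max_right _ _
    nlinarith
  · refine (migrations_le hf hk hS hj).trans (ENNReal.ofReal_le_ofReal ?_)
    have hN : (1 : ℝ) ≤ I.jobs.card := by exact_mod_cast Finset.card_pos.2 ⟨j, hj⟩
    have hL : 0 ≤ Real.log I.weightRatio + Real.log (I.jobs.card : ℝ) :=
      add_nonneg (Real.log_nonneg (one_le_weightRatio hj)) (Real.log_nonneg hN)
    gcongr
    linarith
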